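/- **Theorem 6.2.** Let $K$ be a bisimplicial set, with horizontal and vertical face maps $d_i^{\mathrm h},d_j^{\mathrm v}$ and degeneracy maps $s_i^{\mathrm h},s_j^{\mathrm v}$. Assume that $K$ satisfies the *extension condition*: all simplicial sets $K_{p,*}$ and $K_{*,q}$ are Kan complexes and, for all $p,q\ge 1$, $0\le k\le p$, $0\le l\le q$, given $x_i\in K_{p-1,q}$ $(0\le i\le p,\ i\ne k)$ and $x'_j\in K_{p,q-1}$ $(0\le j\le q,\ j\ne l)$ with $d^{\mathrm h}_ix_j=d^{\mathrm h}_{j-1}x_i$ and $d^{\mathrm v}_ix'_j=d^{\mathrm v}_{j-1}x'_i$ whenever $i<j$ and both sides are defined, and $d^{\mathrm h}_ix'_j=d^{\mathrm v}_jx_i$ for all $i\neq k$, $j\neq l$, there is $z\in K_{p,q}$ with $d_i^{\mathrm h}z=x_i$ $(i\ne k)$ and $d_j^{\mathrm v}z=x'_j$ $(j\ne l)$. Assume also that $\pi_2(K_{*,0},a)=0=\pi_2(K_{0,*},a)$ for every vertex $a\in K_{0,0}$. For $n\ge1$, two $n$-simplices $x,x'$ of a simplicial set are *homotopic* if they have the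 same faces and there is an $(n+1)$-simplex with faces $(s_{n-1}d_0x,\dots,s_{n-1}d_{n-1}x,x,x')$; write $[\ ]_{\mathrm h}$ and $[\ ]_{\mathrm v}$ for homotopy classes in the simplicial sets $K_{*,q}$ and $K_{p,*}$, respectively. Two bisimplices $x,x'\in K_{1,1}$ are *bihomotopic* if there is $y\in K_{1,1}$ with $[x]_{\mathrm h}=[y]_{\mathrm h}$ and $[y]_{\mathrm v}=[x']_{\mathrm v}$; write $[[x]]$ for the bihomotopy class of $x$. Then horizontal homotopy on $K_{1,0}$, vertical homotopy on $K_{0,1}$ and bihomotopy on $K_{1,1}$ are equivalence relations, and there is exactly one double category $\mathrm{PP}K$ described as follows. * Its objects are the vertices $a\in K_{0,0}$. * Its horizontal morphisms are the classes $[f]_{\mathrm h}:d^{\mathrm h}_0f\to d^{\mathrm h}_1f$, $f\in K_{1,0}$, with the structure of the fundamental groupoid of $K_{*,0}$: the identity of $a$ is $[s_0^{\mathrm h}a]_{\mathrm h}$, and $[f]_{\mathrm h}\circ_{\mathrm h}[f']_{\mathrm h}=[d_1^{\mathrm h}\gamma]_{\mathrm h}$ for any $\gamma\in K_{2,0}$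 with $d_2^{\mathrm h}\gamma=f$, $d_0^{\mathrm h}\gamma=f'$. Its vertical morphisms are, in the same way, the classes $[u]_{\mathrm v}$, $u\in K_{0,1}$, with the structure of the fundamental groupoid of $K_{0,*}$. * Its squares are the classes $[[x]]$, $x\in K_{1,1}$, with horizontal source and target the vertical morphisms $[d_0^{\mathrm h}x]_{\mathrm v}$, $[d_1^{\mathrm h}x]_{\mathrm v}$, and vertical source and target the horizontal morphisms $[d_0^{\mathrm v}x]_{\mathrm h}$, $[d_1^{\mathrm v}x]_{\mathrm h}$. * The identity squares are $\mathrm I^{\mathrm h}[u]_{\mathrm v}=[[s_0^{\mathrm h}u]]$ and $\mathrm I^{\mathrm v}[f]_{\mathrm h}=[[s_0^{\mathrm v}f]]$. * If the horizontal source of $[[x]]$ is the horizontal target of $[[y]]$, then $[[x]]\circ_{\mathrm h}[[y]]=[[d_1^{\mathrm h}\gamma]]$ for every $x'\in K_{1,1}$ with $[x]_{\mathrm v}=[x']_{\mathrm v}$ and every $\gamma\in K_{2,1}$ with $d_2^{\mathrm h}\gamma=x'$, $d_0^{\mathrm h}\gamma=y$. If the vertical source of $[[x]]$ is the vertical target of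 $[[y]]$, then $[[x]]\circ_{\mathrm v}[[y]]=[[d_1^{\mathrm v}\gamma]]$ for every $x'\in K_{1,1}$ with $[x]_{\mathrm h}=[x']_{\mathrm h}$ and every $\gamma\in K_{1,2}$ with $d_2^{\mathrm v}\gamma=x'$, $d_0^{\mathrm v}\gamma=y$. Moreover, $\mathrm{PP}K$ is a double groupoid (its four component categories, namely horizontal morphisms, vertical morphisms, and squares under horizontal and under vertical composition, are groupoids), and it satisfies the filling condition: for every horizontal morphism $g$ and vertical morphism $u$ such that the source of $g$ is the target of $u$, there is a square with horizontal source $u$ and vertical target $g$. -/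

import Mathlib

open CategoryTheory Opposite
open scoped Simplicial

universe u

/-! ## Double groupoids -/

/-- The structure of a (small) category with set of objects `O` and set of morphisms `M`:
source and target `s, t : M → O`, identities `I : O → M`, and a composition `f ∘ g`, defined
whenever `s f = t g`, subject to the usual axioms. -/
@[ext]
structure CatStr (M O : Type u) where
  s : M → O
  t : M → O
  I : O → M
  comp : ∀ f g : M, s f = t g → M
  s_I : ∀ a, s (I a) = a
  t_I : ∀ a, t (I a) = a
  s_comp : ∀ f g (h : s f = t g), s (comp f g h) = s g
  t_comp : ∀ f g (h : s f = t g), t (comp f g h) = t f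
  comp_I : ∀ f, comp f (I (s f)) (t_I (s f)).symm = f
  I_comp : ∀ f, comp (I (t f)) f (s_I (t f)) = f
  assoc : ∀ f g k (h₁ : s f = t g) (h₂ : s g = t k),
    comp (comp f g h₁) k ((s_comp f g h₁).trans h₂) =
      comp f (comp g k h₂) (h₁.trans (t_comp g k h₂).symm)

/-- A category is a groupoid when every morphism has a two-sided inverse. -/
def CatStr.IsGroupoid {M O : Type u} (S : CatStr M O) : Prop :=
  ∀ f : M, ∃ (g : M) (h₁ : S.s f = S.t g) (h₂ : S.s g = S.t f),
    S.comp f g h₁ = S.I (S.t f) ∧ S.comp g f h₂ = S.I (S.s f)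

/-- A double category with set of objects `O`, set of horizontal morphisms `H`, set of vertical
morphisms `V`, and set of squares `C`. The horizontal source and target of a square are vertical
morphisms, its vertical source and target are horizontal morphisms. -/
@[ext]
structure DoubleCategory (O H V C : Type u) where
  /-- the category of horizontal morphisms -/
  hor : CatStr H O
  /-- the category of vertical morphisms -/
  ver : CatStr V O
  /-- the horizontal category of squares -/
  sqH : CatStr C V
  /-- the vertical category of squares -/
  sqV : CatStr C H
  -- the boundary of a square is a square
  s_s : ∀ α, hor.s (sqV.s α) = ver.s (sqH.s α)
  t_t : ∀ α, hor.t (sqV.t α) = ver.t (sqH.t α)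
  s_t : ∀ α, hor.s (sqV.t α) = ver.t (sqH.s α)
  t_s : ∀ α, hor.t (sqV.s α) = ver.s (sqH.t α)
  -- the boundaries of identity squares
  sH_IV : ∀ f, sqH.s (sqV.I f) = ver.I (hor.s f)
  tH_IV : ∀ f, sqH.t (sqV.I f) = ver.I (hor.t f)
  sV_IH : ∀ u, sqV.s (sqH.I u) = hor.I (ver.s u)
  tV_IH : ∀ u, sqV.t (sqH.I u) = hor.I (ver.t u)
  I_I : ∀ a, sqH.I (ver.I a) = sqV.I (hor.I a)
  -- the boundaries of composite squares
  sV_comp : ∀ α β (h : sqH.s α = sqH.t β), sqV.s (sqH.comp α β h) =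
    hor.comp (sqV.s α) (sqV.s β) (by rw [s_s, t_s, h])
  tV_comp : ∀ α β (h : sqH.s α = sqH.t β), sqV.t (sqH.comp α β h) =
    hor.comp (sqV.t α) (sqV.t β) (by rw [s_t, t_t, h])
  sH_comp : ∀ α β (h : sqV.s α = sqV.t β), sqH.s (sqV.comp α β h) =
    ver.comp (sqH.s α) (sqH.s β) (by rw [← s_s, ← s_t, h])
  tH_comp : ∀ α β (h : sqV.s α = sqV.t β), sqH.t (sqV.comp α β h) =
    ver.comp (sqH.t α) (sqH.t β) (by rw [← t_s, ← t_t, h])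
  -- identity squares on composite morphisms
  IV_comp : ∀ f g (h : hor.s f = hor.t g), sqV.I (hor.comp f g h) =
    sqH.comp (sqV.I f) (sqV.I g) (by rw [sH_IV, tH_IV, h])
  IH_comp : ∀ u v (h : ver.s u = ver.t v), sqH.I (ver.comp u v h) =
    sqV.comp (sqH.I u) (sqH.I v) (by rw [sV_IH, tV_IH, h])
  -- the interchange law
  interchange : ∀ α β γ δ (h₁ : sqH.s α = sqH.t β) (h₂ : sqH.s γ = sqH.t δ)
    (h₃ : sqV.s α = sqV.t γ) (h₄ : sqV.s β = sqV.t δ),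
    sqV.comp (sqH.comp α β h₁) (sqH.comp γ δ h₂)
        (by rw [sV_comp, tV_comp]; simp only [h₃, h₄]) =
      sqH.comp (sqV.comp α γ h₃) (sqV.comp β δ h₄)
        (by rw [sH_comp, tH_comp]; simp only [h₁, h₂])

namespace DoubleCategory

variable {O H V C : Type u}

/-- A double groupoid is a double category whose four component categories are groupoids. -/
def IsDoubleGroupoid (G : DoubleCategory O H V C) : Prop :=
  G.hor.IsGroupoid ∧ G.ver.IsGroupoid ∧ G.sqH.IsGroupoid ∧ G.sqV.IsGroupoid

/-- Every corner formed by a horizontal morphism `g` and a vertical morphism `u` whose target is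
the source of `g` is part of the boundary of a square. -/
def FillingCondition (G : DoubleCategory O H V C) : Prop :=
  ∀ (g : H) (u : V), G.hor.s g = G.ver.t u → ∃ α : C, G.sqH.s α = u ∧ G.sqV.t α = g

end DoubleCategory

/-! ## Homotopy of simplices -/

namespace SSet

/-- Two simplices `x`, `x'` of dimension `n + 1` are homotopic if they have the same faces and
there is a simplex of dimension `n + 2` with faces
`(s_n d_0 x, …, s_n d_n x, x, x')`. -/
def Homotopic (L : SSet.{u}) {n : ℕ} (x x' : L _⦋n + 1⦌) : Prop :=
  (∀ i : Fin (n + 2), L.δ i x = L.δ i x') ∧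
  ∃ y : L _⦋n + 2⦌,
    (∀ i : Fin (n + 1), L.δ i.castSucc.castSucc y = L.σ (Fin.last n) (L.δ i.castSucc x)) ∧
    L.δ (Fin.last (n + 1)).castSucc y = x ∧
    L.δ (Fin.last (n + 2)) y = x'

/-- The degenerate `n`-simplex on a vertex `a`. -/
def constSimplex (L : SSet.{u}) (n : ℕ) (a : L _⦋0⦌) : L _⦋n⦌ :=
  L.map (SimplexCategory.const ⦋n⦌ ⦋0⦌ 0).op a

/-- The underlying set of the homotopy group `π_{n+1}(L, a)`: homotopy classes of simplices of
dimension `n + 1` all of whose faces are the degenerate simplex on `a`. -/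
def PiSucc (L : SSet.{u}) (n : ℕ) (a : L _⦋0⦌) : Type u :=
  Quot (fun x x' : {x : L _⦋n + 1⦌ // ∀ i : Fin (n + 2), L.δ i x = L.constSimplex n a} =>
    L.Homotopic x.1 x'.1)

/-- The set of homotopy classes `[x]` of `1`-simplices. -/
def EdgeClass (L : SSet.{u}) : Type u :=
  Quot (fun x x' : L _⦋1⦌ => L.Homotopic x x')

/-- The homotopy class of a `1`-simplex. -/
def edgeClass (L : SSet.{u}) (x : L _⦋1⦌) : L.EdgeClass := Quot.mk _ x

/-- `S` is the fundamental (Poincaré) groupoid of `L`: the objects are the vertices, the morphisms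
are the homotopy classes of `1`-simplices, `[x]` goes from `d_0 x` to `d_1 x`, the identity of `a`
is `[s_0 a]`, and `[x] ∘ [x'] = [d_1 y]` for any `2`-simplex `y` with `d_2 y = x`, `d_0 y = x'`. -/
structure IsFundamentalGroupoid (L : SSet.{u}) (S : CatStr L.EdgeClass (L _⦋0⦌)) : Prop where
  s_mk : ∀ x : L _⦋1⦌, S.s (L.edgeClass x) = L.δ 0 x
  t_mk : ∀ x : L _⦋1⦌, S.t (L.edgeClass x) = L.δ 1 x
  I_eq : ∀ a : L _⦋0⦌, S.I a = L.edgeClass (L.σ 0 a)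
  comp_eq : ∀ (x x' : L _⦋1⦌) (h : S.s (L.edgeClass x) = S.t (L.edgeClass x')) (y : L _⦋2⦌),
    L.δ 2 y = x → L.δ 0 y = x' →
      S.comp (L.edgeClass x) (L.edgeClass x') h = L.edgeClass (L.δ 1 y)

/-- The compatibility condition on a list `(x_0, …, x_{k-1}, -, x_{k+1}, …, x_{n+1})` of
`n`-simplices: `d_i x_j = d_{j-1} x_i` for all `i < j` different from `k`. -/
def FacesMatch (L : SSet.{u}) {n : ℕ} {k : Fin (n + 2)}
    (x : ∀ i : Fin (n + 2), i ≠ k → L _⦋n⦌) : Prop :=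
  match n with
  | 0 => True
  | n + 1 => ∀ (i j : Fin (n + 3)) (hi : i ≠ k) (hj : j ≠ k) (hij : i < j),
      L.δ (i.castPred (Fin.ne_last_of_lt hij)) (x j hj) =
        L.δ (j.pred (Fin.ne_zero_of_lt hij)) (x i hi)

end SSet

/-! ## Bisimplicial sets -/

/-- Bisimplicial sets, viewed as (horizontal) simplicial objects in (vertical) simplicial sets. -/
abbrev BiSSet : Type (u + 1) := SimplicialObject SSet.{u}

namespace BiSSet

/-- The vertical simplicial set `K_{p,*}`. -/
abbrev vert (K : BiSSet.{u}) (p : ℕ) : SSet.{u} := K.obj (op ⦋p⦌)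

/-- The horizontal simplicial set `K_{*,q}`. -/
abbrev horiz (K : BiSSet.{u}) (q : ℕ) : SSet.{u} := K.flip.obj (op ⦋q⦌)

/-- The set `K_{p,q}` of bisimplices of bidegree `(p,q)`. -/
abbrev cell (K : BiSSet.{u}) (p q : ℕ) : Type u := (K.obj (op ⦋p⦌)).obj (op ⦋q⦌)

/-- The horizontal face maps. -/
def dh (K : BiSSet.{u}) {p q : ℕ} (i : Fin (p + 2)) (x : K.cell (p + 1) q) : K.cell p q :=
  (K.horiz q).δ i x

/-- The vertical face maps. -/
def dv (K : BiSSet.{u}) {p q : ℕ} (j : Fin (q + 2)) (x : K.cell p (q + 1)) : K.cell p q :=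
  (K.vert p).δ j x

/-- The horizontal degeneracy maps. -/
def sh (K : BiSSet.{u}) {p q : ℕ} (i : Fin (p + 1)) (x : K.cell p q) : K.cell (p + 1) q :=
  (K.horiz q).σ i x

/-- The vertical degeneracy maps. -/
def sv (K : BiSSet.{u}) {p q : ℕ} (j : Fin (q + 1)) (x : K.cell p q) : K.cell p (q + 1) :=
  (K.vert p).σ j x

/-- The data `(x_0, …, -, …, x_{p+1}; x'_0, …, -, …, x'_{q+1})`, with the entries `x_k` and `x'_l`
missing, of a bisimplicial map from the `(k,l)`-th horn of the standard `(p+1,q+1)`-bisimplex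
to `K`. -/
structure IsBihorn (K : BiSSet.{u}) {p q : ℕ} {k : Fin (p + 2)} {l : Fin (q + 2)}
    (x : ∀ i : Fin (p + 2), i ≠ k → K.cell p (q + 1))
    (x' : ∀ j : Fin (q + 2), j ≠ l → K.cell (p + 1) q) : Prop where
  horiz_match : (K.horiz (q + 1)).FacesMatch x
  vert_match : (K.vert (p + 1)).FacesMatch x'
  mixed_match : ∀ (i : Fin (p + 2)) (hi : i ≠ k) (j : Fin (q + 2)) (hj : j ≠ l),
    K.dh i (x' j hj) = K.dv j (x i hi)

/-- The extension condition: all the simplicial sets `K_{p,*}` and `K_{*,q}` are Kan complexes,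
and every map from a `(k,l)`-th horn to `K` extends to the standard bisimplex. (If one of the two
dimensions is zero, a bisimplicial horn is a horn in `K_{0,*}` or `K_{*,0}`.) -/
structure ExtensionCondition (K : BiSSet.{u}) : Prop where
  vert_kan : ∀ p, SSet.KanComplex (K.vert p)
  horiz_kan : ∀ q, SSet.KanComplex (K.horiz q)
  bihorn : ∀ (p q : ℕ) (k : Fin (p + 2)) (l : Fin (q + 2))
    (x : ∀ i : Fin (p + 2), i ≠ k → K.cell p (q + 1))
    (x' : ∀ j : Fin (q + 2), j ≠ l → K.cell (p + 1) q), K.IsBihorn x x' →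
    ∃ z : K.cell (p + 1) (q + 1),
      (∀ i hi, K.dh i z = x i hi) ∧ (∀ j hj, K.dv j z = x' j hj)

/-- `[x]_h = [x']_h`: homotopy in the horizontal simplicial set `K_{*,q}`. -/
def HomotopicH (K : BiSSet.{u}) {p q : ℕ} (x x' : K.cell (p + 1) q) : Prop :=
  (K.horiz q).Homotopic x x'

/-- `[x]_v = [x']_v`: homotopy in the vertical simplicial set `K_{p,*}`. -/
def HomotopicV (K : BiSSet.{u}) {p q : ℕ} (x x' : K.cell p (q + 1)) : Prop :=
  (K.vert p).Homotopic x x'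

/-- Bihomotopy of bisimplices. -/
def Bihomotopic (K : BiSSet.{u}) {p q : ℕ} (x x' : K.cell (p + 1) (q + 1)) : Prop :=
  ∃ y : K.cell (p + 1) (q + 1), K.HomotopicH x y ∧ K.HomotopicV y x'

/-- Horizontal morphisms of the homotopy double groupoid: horizontal homotopy classes of
`(1,0)`-bisimplices. -/
abbrev HMor (K : BiSSet.{u}) : Type u := (K.horiz 0).EdgeClass

/-- Vertical morphisms of the homotopy double groupoid: vertical homotopy classes of
`(0,1)`-bisimplices. -/
abbrev VMor (K : BiSSet.{u}) : Type u := (K.vert 0).EdgeClass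

/-- Squares of the homotopy double groupoid: bihomotopy classes of `(1,1)`-bisimplices. -/
def Square (K : BiSSet.{u}) : Type u :=
  Quot (fun x x' : K.cell 1 1 => K.Bihomotopic x x')

/-- The class `[f]_h` of a `(1,0)`-bisimplex. -/
def clsH (K : BiSSet.{u}) (f : K.cell 1 0) : K.HMor := (K.horiz 0).edgeClass f

/-- The class `[u]_v` of a `(0,1)`-bisimplex. -/
def clsV (K : BiSSet.{u}) (f : K.cell 0 1) : K.VMor := (K.vert 0).edgeClass f

/-- The class `[[x]]` of a `(1,1)`-bisimplex. -/
def cls (K : BiSSet.{u}) (x : K.cell 1 1) : K.Square := Quot.mk _ x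

/-- The structure maps of the double category `G` are those of the homotopy double groupoid of
`K`. -/
structure IsHomotopyDoubleGroupoid (K : BiSSet.{u})
    (G : DoubleCategory (K.cell 0 0) K.HMor K.VMor K.Square) : Prop where
  hor : (K.horiz 0).IsFundamentalGroupoid G.hor
  ver : (K.vert 0).IsFundamentalGroupoid G.ver
  sH : ∀ x : K.cell 1 1, G.sqH.s (K.cls x) = K.clsV (K.dh 0 x)
  tH : ∀ x : K.cell 1 1, G.sqH.t (K.cls x) = K.clsV (K.dh 1 x)
  sV : ∀ x : K.cell 1 1, G.sqV.s (K.cls x) = K.clsH (K.dv 0 x)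
  tV : ∀ x : K.cell 1 1, G.sqV.t (K.cls x) = K.clsH (K.dv 1 x)
  IH : ∀ u : K.cell 0 1, G.sqH.I (K.clsV u) = K.cls (K.sh 0 u)
  IV : ∀ f : K.cell 1 0, G.sqV.I (K.clsH f) = K.cls (K.sv 0 f)
  /-- `[[x]] ∘_h [[y]] = [[d_1^h γ]]` if `[x]_v = [x']_v`, `d_2^h γ = x'` and `d_0^h γ = y`. -/
  compH : ∀ (x y : K.cell 1 1) (h : G.sqH.s (K.cls x) = G.sqH.t (K.cls y))
    (x' : K.cell 1 1) (γ : K.cell 2 1), K.HomotopicV x x' → K.dh 2 γ = x' → K.dh 0 γ = y →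
    G.sqH.comp (K.cls x) (K.cls y) h = K.cls (K.dh 1 γ)
  /-- `[[x]] ∘_v [[y]] = [[d_1^v γ]]` if `[x]_h = [x']_h`, `d_2^v γ = x'` and `d_0^v γ = y`. -/
  compV : ∀ (x y : K.cell 1 1) (h : G.sqV.s (K.cls x) = G.sqV.t (K.cls y))
    (x' : K.cell 1 1) (γ : K.cell 1 2), K.HomotopicH x x' → K.dv 2 γ = x' → K.dv 0 γ = y →
    G.sqV.comp (K.cls x) (K.cls y) h = K.cls (K.dv 1 γ)

end BiSSet

/-! Everything reduces to filling horns, with composition treated as a relation: a 2-simplex `γ`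
exhibits `d_1 γ` as a composite of `d_2 γ` and `d_0 γ`. In a Kan complex, associativity of this
relation is the filling of a 3-horn. Since homotopy of edges is composition with an identity
(`homotopic_iff_isComposite`), associativity also makes homotopy an equivalence relation compatible
with composites, and the fundamental groupoid follows.

For squares, bihorns provide two tools. Horizontal and vertical homotopy commute
(`homotopicV_homotopicH`), so bihomotopy is an equivalence relation. A vertical homotopy of the edge
`dh 0 x` lifts to `x` (`exists_homotopicV_dh_eq`), so squares whose edges agree only up to homotopy
have representatives that compose strictly in `K_{*,1}`, where units, inverses and associativity are
then inherited.

The delicate point is that composites do not depend on the representatives. Vertical homotopies of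
two adjacent squares restrict on the common edge to two 2-simplices of `K_{0,*}` with the same
boundary, and they can be pasted only if these are equal. Vanishing of the second homotopy group
makes them homotopic (`homotopic_of_δ_eq`), and `exists_dv_eq_dh_eq` absorbs this homotopy into one
of the squares; this is the only use of that hypothesis. It yields `bihomotopic_composite`.

For interchange, a 2 × 2 grid of squares is rigidified into a single (2,2)-bisimplex `z`
(`exists_grid`); both iterated composites are then the class of `dh 1 (dv 1 z)`. The extension
condition is symmetric in the two directions, so vertical statements come from horizontal ones
applied to the flipped bisimplicial set. -/

namespace SSet

/-! ### Horn fillers and simplicial identities in low dimensions -/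

variable {L : SSet.{u}}

theorem KanComplex.exists_filler [KanComplex L] {n : ℕ} (k : Fin (n + 2))
    (x : Fin (n + 2) → L _⦋n⦌) (hx : L.FacesMatch (k := k) fun i _ => x i) :
    ∃ z : L _⦋n + 1⦌, ∀ i, i ≠ k → L.δ i z = x i := by
  have hf : horn.IsCompatible (i := k) (fun j (_ : j ≠ k) => yonedaEquiv.symm (x j)) := by
    cases n with
    | zero => trivial
    | succ n =>
      intro i j hi hj hij
      rw [stdSimplex.δ_comp_yonedaEquiv_symm, stdSimplex.δ_comp_yonedaEquiv_symm]
      exact congrArg _ (hx i j hi hj hij).symm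
  obtain ⟨φ, hφ⟩ := hf.exists_lift_of_kanComplex
  refine ⟨yonedaEquiv φ, fun i hi => ?_⟩
  have := hφ i hi
  rw [← stdSimplex.yonedaEquiv_δ_comp, this, Equiv.apply_symm_apply]

section Identities

@[simp] theorem δ01 (x : L _⦋2⦌) : L.δ 0 (L.δ 1 x) = L.δ 0 (L.δ 0 x) :=
  (δ_comp_δ_apply (i := 0) (j := 0) (by simp) x)
@[simp] theorem δ02 (x : L _⦋2⦌) : L.δ 0 (L.δ 2 x) = L.δ 1 (L.δ 0 x) :=
  (δ_comp_δ_apply (i := 0) (j := 1) (by simp) x)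
@[simp] theorem δ12 (x : L _⦋2⦌) : L.δ 1 (L.δ 2 x) = L.δ 1 (L.δ 1 x) :=
  (δ_comp_δ_apply (i := 1) (j := 1) (by simp) x)

@[simp] theorem δ₃01 (x : L _⦋3⦌) : L.δ 0 (L.δ 1 x) = L.δ 0 (L.δ 0 x) :=
  (δ_comp_δ_apply (i := 0) (j := 0) (by simp) x)
@[simp] theorem δ₃02 (x : L _⦋3⦌) : L.δ 0 (L.δ 2 x) = L.δ 1 (L.δ 0 x) :=
  (δ_comp_δ_apply (i := 0) (j := 1) (by simp) x)
@[simp] theorem δ₃03 (x : L _⦋3⦌) : L.δ 0 (L.δ 3 x) = L.δ 2 (L.δ 0 x) :=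
  (δ_comp_δ_apply (i := 0) (j := 2) (by simp) x)
@[simp] theorem δ₃12 (x : L _⦋3⦌) : L.δ 1 (L.δ 2 x) = L.δ 1 (L.δ 1 x) :=
  (δ_comp_δ_apply (i := 1) (j := 1) (by simp) x)
@[simp] theorem δ₃13 (x : L _⦋3⦌) : L.δ 1 (L.δ 3 x) = L.δ 2 (L.δ 1 x) :=
  (δ_comp_δ_apply (i := 1) (j := 2) (by simp) x)
@[simp] theorem δ₃23 (x : L _⦋3⦌) : L.δ 2 (L.δ 3 x) = L.δ 2 (L.δ 2 x) :=
  (δ_comp_δ_apply (i := 2) (j := 2) (by simp) x)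

@[simp] theorem δ₄03 (x : L _⦋4⦌) : L.δ 0 (L.δ 3 x) = L.δ 2 (L.δ 0 x) :=
  (δ_comp_δ_apply (i := 0) (j := 2) (by simp) x)
@[simp] theorem δ₄13 (x : L _⦋4⦌) : L.δ 1 (L.δ 3 x) = L.δ 2 (L.δ 1 x) :=
  (δ_comp_δ_apply (i := 1) (j := 2) (by simp) x)
@[simp] theorem δ₄23 (x : L _⦋4⦌) : L.δ 2 (L.δ 3 x) = L.δ 2 (L.δ 2 x) :=
  (δ_comp_δ_apply (i := 2) (j := 2) (by decide) x)
@[simp] theorem δ₄02 (x : L _⦋4⦌) : L.δ 0 (L.δ 2 x) = L.δ 1 (L.δ 0 x) :=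
  (δ_comp_δ_apply (i := 0) (j := 1) (by simp) x)
@[simp] theorem δ₄12 (x : L _⦋4⦌) : L.δ 1 (L.δ 2 x) = L.δ 1 (L.δ 1 x) :=
  (δ_comp_δ_apply (i := 1) (j := 1) (by simp) x)
theorem δ₄24 (x : L _⦋4⦌) : L.δ 2 (L.δ 4 x) = L.δ 3 (L.δ 2 x) :=
  (δ_comp_δ_apply (i := 2) (j := 3) (by decide) x)
theorem δ₄34 (x : L _⦋4⦌) : L.δ 3 (L.δ 4 x) = L.δ 3 (L.δ 3 x) :=
  (δ_comp_δ_apply (i := 3) (j := 3) (by decide) x)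

@[simp] theorem δ₁0σ (x : L _⦋0⦌) : L.δ 0 (L.σ 0 x) = x := δ_comp_σ_self_apply 0 x
@[simp] theorem δ₁1σ (x : L _⦋0⦌) : L.δ 1 (L.σ 0 x) = x := δ_comp_σ_succ_apply 0 x

@[simp] theorem δ₂0σ0 (x : L _⦋1⦌) : L.δ 0 (L.σ 0 x) = x := δ_comp_σ_self_apply 0 x
@[simp] theorem δ₂1σ0 (x : L _⦋1⦌) : L.δ 1 (L.σ 0 x) = x := δ_comp_σ_succ_apply 0 x
@[simp] theorem δ₂2σ0 (x : L _⦋1⦌) : L.δ 2 (L.σ 0 x) = L.σ 0 (L.δ 1 x) :=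
  δ_comp_σ_of_gt_apply (i := 1) (j := 0) (by decide) x
@[simp] theorem δ₂0σ1 (x : L _⦋1⦌) : L.δ 0 (L.σ 1 x) = L.σ 0 (L.δ 0 x) :=
  δ_comp_σ_of_le_apply (i := 0) (j := 0) (by decide) x
@[simp] theorem δ₂1σ1 (x : L _⦋1⦌) : L.δ 1 (L.σ 1 x) = x := δ_comp_σ_self_apply 1 x
@[simp] theorem δ₂2σ1 (x : L _⦋1⦌) : L.δ 2 (L.σ 1 x) = x := δ_comp_σ_succ_apply 1 x

@[simp] theorem δ₃0σ2 (x : L _⦋2⦌) : L.δ 0 (L.σ 2 x) = L.σ 1 (L.δ 0 x) :=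
  δ_comp_σ_of_le_apply (i := 0) (j := 1) (by decide) x
@[simp] theorem δ₃1σ2 (x : L _⦋2⦌) : L.δ 1 (L.σ 2 x) = L.σ 1 (L.δ 1 x) :=
  δ_comp_σ_of_le_apply (i := 1) (j := 1) (by decide) x
@[simp] theorem δ₃2σ2 (x : L _⦋2⦌) : L.δ 2 (L.σ 2 x) = x := δ_comp_σ_self_apply 2 x
@[simp] theorem δ₃3σ2 (x : L _⦋2⦌) : L.δ 3 (L.σ 2 x) = x := δ_comp_σ_succ_apply 2 x

end Identities

variable [KanComplex L]

theorem KanComplex.exists_filler₂₀ (x₁ x₂ : L _⦋1⦌) (h : L.δ 1 x₂ = L.δ 1 x₁) :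
    ∃ z : L _⦋2⦌, L.δ 1 z = x₁ ∧ L.δ 2 z = x₂ := by
  obtain ⟨z, hz⟩ := KanComplex.exists_filler 0 ![x₁, x₁, x₂] (by
    intro i j hi hj hij
    fin_cases i <;> fin_cases j <;> first | contradiction | assumption)
  exact ⟨z, hz 1 (by decide), hz 2 (by decide)⟩

theorem KanComplex.exists_filler₂₁ (x₀ x₂ : L _⦋1⦌) (h : L.δ 0 x₂ = L.δ 1 x₀) :
    ∃ z : L _⦋2⦌, L.δ 0 z = x₀ ∧ L.δ 2 z = x₂ := by
  obtain ⟨z, hz⟩ := KanComplex.exists_filler 1 ![x₀, x₀, x₂] (by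
    intro i j hi hj hij
    fin_cases i <;> fin_cases j <;> first | contradiction | assumption)
  exact ⟨z, hz 0 (by decide), hz 2 (by decide)⟩

theorem KanComplex.exists_filler₂₂ (x₀ x₁ : L _⦋1⦌) (h : L.δ 0 x₁ = L.δ 0 x₀) :
    ∃ z : L _⦋2⦌, L.δ 0 z = x₀ ∧ L.δ 1 z = x₁ := by
  obtain ⟨z, hz⟩ := KanComplex.exists_filler 2 ![x₀, x₁, x₁] (by
    intro i j hi hj hij
    fin_cases i <;> fin_cases j <;> first | contradiction | assumption)
  exact ⟨z, hz 0 (by decide), hz 1 (by decide)⟩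

theorem KanComplex.exists_filler₃₀ (x₁ x₂ x₃ : L _⦋2⦌) (h₁₂ : L.δ 1 x₂ = L.δ 1 x₁)
    (h₁₃ : L.δ 1 x₃ = L.δ 2 x₁) (h₂₃ : L.δ 2 x₃ = L.δ 2 x₂) :
    ∃ z : L _⦋3⦌, L.δ 1 z = x₁ ∧ L.δ 2 z = x₂ ∧ L.δ 3 z = x₃ := by
  obtain ⟨z, hz⟩ := KanComplex.exists_filler 0 ![x₁, x₁, x₂, x₃] (by
    intro i j hi hj hij
    fin_cases i <;> fin_cases j <;> first | contradiction | assumption)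
  exact ⟨z, hz 1 (by decide), hz 2 (by decide), hz 3 (by decide)⟩

theorem KanComplex.exists_filler₃₁ (x₀ x₂ x₃ : L _⦋2⦌) (h₀₂ : L.δ 0 x₂ = L.δ 1 x₀)
    (h₀₃ : L.δ 0 x₃ = L.δ 2 x₀) (h₂₃ : L.δ 2 x₃ = L.δ 2 x₂) :
    ∃ z : L _⦋3⦌, L.δ 0 z = x₀ ∧ L.δ 2 z = x₂ ∧ L.δ 3 z = x₃ := by
  obtain ⟨z, hz⟩ := KanComplex.exists_filler 1 ![x₀, x₀, x₂, x₃] (by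
    intro i j hi hj hij
    fin_cases i <;> fin_cases j <;> first | contradiction | assumption)
  exact ⟨z, hz 0 (by decide), hz 2 (by decide), hz 3 (by decide)⟩

theorem KanComplex.exists_filler₃₂ (x₀ x₁ x₃ : L _⦋2⦌) (h₀₁ : L.δ 0 x₁ = L.δ 0 x₀)
    (h₀₃ : L.δ 0 x₃ = L.δ 2 x₀) (h₁₃ : L.δ 1 x₃ = L.δ 2 x₁) :
    ∃ z : L _⦋3⦌, L.δ 0 z = x₀ ∧ L.δ 1 z = x₁ ∧ L.δ 3 z = x₃ := by
  obtain ⟨z, hz⟩ := KanComplex.exists_filler 2 ![x₀, x₁, x₁, x₃] (by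
    intro i j hi hj hij
    fin_cases i <;> fin_cases j <;> first | contradiction | assumption)
  exact ⟨z, hz 0 (by decide), hz 1 (by decide), hz 3 (by decide)⟩

theorem KanComplex.exists_filler₄₂ (x₀ x₁ x₃ x₄ : L _⦋3⦌) (h₀₁ : L.δ 0 x₁ = L.δ 0 x₀)
    (h₀₃ : L.δ 0 x₃ = L.δ 2 x₀) (h₀₄ : L.δ 0 x₄ = L.δ 3 x₀) (h₁₃ : L.δ 1 x₃ = L.δ 2 x₁)
    (h₁₄ : L.δ 1 x₄ = L.δ 3 x₁) (h₃₄ : L.δ 3 x₄ = L.δ 3 x₃) :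
    ∃ z : L _⦋4⦌, L.δ 0 z = x₀ ∧ L.δ 1 z = x₁ ∧ L.δ 3 z = x₃ ∧ L.δ 4 z = x₄ := by
  obtain ⟨z, hz⟩ := KanComplex.exists_filler 2 ![x₀, x₁, x₁, x₃, x₄] (by
    intro i j hi hj hij
    fin_cases i <;> fin_cases j <;> first | contradiction | assumption)
  exact ⟨z, hz 0 (by decide), hz 1 (by decide), hz 3 (by decide), hz 4 (by decide)⟩

theorem KanComplex.exists_filler₄₃ (x₀ x₁ x₂ x₄ : L _⦋3⦌) (h₀₁ : L.δ 0 x₁ = L.δ 0 x₀)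
    (h₀₂ : L.δ 0 x₂ = L.δ 1 x₀) (h₀₄ : L.δ 0 x₄ = L.δ 3 x₀) (h₁₂ : L.δ 1 x₂ = L.δ 1 x₁)
    (h₁₄ : L.δ 1 x₄ = L.δ 3 x₁) (h₂₄ : L.δ 2 x₄ = L.δ 3 x₂) :
    ∃ z : L _⦋4⦌, L.δ 0 z = x₀ ∧ L.δ 1 z = x₁ ∧ L.δ 2 z = x₂ ∧ L.δ 4 z = x₄ := by
  obtain ⟨z, hz⟩ := KanComplex.exists_filler 3 ![x₀, x₁, x₂, x₂, x₄] (by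
    intro i j hi hj hij
    fin_cases i <;> fin_cases j <;> first | contradiction | assumption)
  exact ⟨z, hz 0 (by decide), hz 1 (by decide), hz 2 (by decide), hz 4 (by decide)⟩

end SSet

/-! ### Homotopy of 1- and 2-simplices in a Kan complex -/

namespace SSet

variable {L : SSet.{u}}

theorem homotopic_edge_iff {x x' : L _⦋1⦌} :
    L.Homotopic x x' ↔ ∃ y : L _⦋2⦌, L.δ 0 y = L.σ 0 (L.δ 0 x) ∧ L.δ 1 y = x ∧ L.δ 2 y = x' := by
  constructor
  · rintro ⟨-, y, h₀, h₁, h₂⟩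
    exact ⟨y, h₀ 0, h₁, h₂⟩
  · rintro ⟨y, h₀, h₁, h₂⟩
    refine ⟨fun i => ?_, y, fun i => ?_, h₁, h₂⟩
    · fin_cases i
      · have := δ02 y
        rw [h₀, h₂, δ₁1σ] at this
        exact this.symm
      · have := δ12 y
        rw [h₁, h₂] at this
        exact this.symm
    · fin_cases i
      exact h₀

theorem homotopic_triangle_iff {x x' : L _⦋2⦌} :
    L.Homotopic x x' ↔ ∃ y : L _⦋3⦌, L.δ 0 y = L.σ 1 (L.δ 0 x) ∧ L.δ 1 y = L.σ 1 (L.δ 1 x) ∧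
      L.δ 2 y = x ∧ L.δ 3 y = x' := by
  constructor
  · rintro ⟨-, y, h, h₂, h₃⟩
    exact ⟨y, h 0, h 1, h₂, h₃⟩
  · rintro ⟨y, h₀, h₁, h₂, h₃⟩
    refine ⟨fun i => ?_, y, fun i => ?_, h₂, h₃⟩
    · fin_cases i
      · have := δ₃03 y
        rw [h₀, h₃, δ₂2σ1] at this
        exact this.symm
      · have := δ₃13 y
        rw [h₁, h₃, δ₂2σ1] at this
        exact this.symm
      · have := δ₃23 y
        rw [h₂, h₃] at this
        exact this.symm
    · fin_cases i
      · exact h₀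
      · exact h₁

/-- `x` and `y` are composable with composite `z`, as witnessed by a `2`-simplex. -/
def IsComposite (L : SSet.{u}) (x y z : L _⦋1⦌) : Prop :=
  ∃ γ : L _⦋2⦌, L.δ 2 γ = x ∧ L.δ 0 γ = y ∧ L.δ 1 γ = z

/-- The 2-simplex of a homotopy is a composition witness with an identity on the right, so the
calculus of composites applies to homotopies. -/
theorem homotopic_iff_isComposite {x x' : L _⦋1⦌} :
    L.Homotopic x x' ↔ L.IsComposite x' (L.σ 0 (L.δ 0 x')) x := by
  rw [homotopic_edge_iff]
  constructor
  · rintro ⟨y, h₀, h₁, h₂⟩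
    refine ⟨y, h₂, ?_, h₁⟩
    have := δ02 y
    rw [h₀, h₂, δ₁1σ] at this
    rw [h₀, this]
  · rintro ⟨y, h₂, h₀, h₁⟩
    refine ⟨y, ?_, h₁, h₂⟩
    have := δ01 y
    rw [h₀, h₁, δ₁0σ] at this
    rw [h₀, this]

theorem isComposite_id (x : L _⦋1⦌) : L.IsComposite x (L.σ 0 (L.δ 0 x)) x :=
  ⟨L.σ 1 x, by simp, by simp, by simp⟩

theorem id_isComposite (x : L _⦋1⦌) : L.IsComposite (L.σ 0 (L.δ 1 x)) x x :=
  ⟨L.σ 0 x, by simp, by simp, by simp⟩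

theorem IsComposite.boundary {x y z : L _⦋1⦌} (h : L.IsComposite x y z) :
    L.δ 0 x = L.δ 1 y ∧ L.δ 0 z = L.δ 0 y ∧ L.δ 1 z = L.δ 1 x := by
  obtain ⟨γ, rfl, rfl, rfl⟩ := h
  simp

theorem homotopic_refl (x : L _⦋1⦌) : L.Homotopic x x :=
  homotopic_iff_isComposite.2 (isComposite_id x)

theorem homotopic₂_refl (x : L _⦋2⦌) : L.Homotopic x x :=
  homotopic_triangle_iff.2 ⟨L.σ 2 x, by simp, by simp, by simp, by simp⟩

variable [KanComplex L]

/-- The three witnesses form a 3-horn with face 1 missing, and the new face is the desired witness.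
In `IsComposite.assoc'` the missing face is 2. -/
theorem IsComposite.assoc {x y z p q w : L _⦋1⦌} (hxy : L.IsComposite x y p)
    (hyz : L.IsComposite y z q) (hw : L.IsComposite x q w) : L.IsComposite p z w := by
  obtain ⟨γ₃, rfl, rfl, rfl⟩ := hxy
  obtain ⟨γ₀, h, rfl, rfl⟩ := hyz
  obtain ⟨γ₂, h₁, h₂, rfl⟩ := hw
  obtain ⟨Γ, rfl, rfl, rfl⟩ := KanComplex.exists_filler₃₁ γ₀ γ₂ γ₃ h₂ h.symm h₁.symm
  exact ⟨L.δ 1 Γ, by simp, by simp, by simp⟩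

theorem IsComposite.assoc' {x y z p q w : L _⦋1⦌} (hxy : L.IsComposite x y p)
    (hyz : L.IsComposite y z q) (hw : L.IsComposite p z w) : L.IsComposite x q w := by
  obtain ⟨γ₃, rfl, rfl, rfl⟩ := hxy
  obtain ⟨γ₀, h, rfl, rfl⟩ := hyz
  obtain ⟨γ₁, h₁, h₂, rfl⟩ := hw
  obtain ⟨Γ, rfl, rfl, rfl⟩ := KanComplex.exists_filler₃₂ γ₀ γ₁ γ₃ h₂ h.symm h₁.symm
  exact ⟨L.δ 2 Γ, by simp, by simp, by simp⟩

theorem exists_isComposite {x y : L _⦋1⦌} (h : L.δ 0 x = L.δ 1 y) : ∃ z, L.IsComposite x y z := by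
  obtain ⟨γ, h₀, h₂⟩ := KanComplex.exists_filler₂₁ y x h
  exact ⟨_, γ, h₂, h₀, rfl⟩

theorem exists_isComposite_id (x : L _⦋1⦌) : ∃ y, L.IsComposite x y (L.σ 0 (L.δ 1 x)) := by
  obtain ⟨γ, h₁, h₂⟩ := KanComplex.exists_filler₂₀ (L.σ 0 (L.δ 1 x)) x (by simp)
  exact ⟨_, γ, h₂, rfl, h₁⟩

theorem exists_isComposite_id' (x : L _⦋1⦌) : ∃ y, L.IsComposite y x (L.σ 0 (L.δ 0 x)) := by
  obtain ⟨γ, h₁, h₂⟩ := KanComplex.exists_filler₂₂ x (L.σ 0 (L.δ 0 x)) (by simp)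
  exact ⟨_, γ, rfl, h₁, h₂⟩

/-- Associativity for `z` followed by two identities. This Euclidean form gives both symmetry and
transitivity once reflexivity is known. -/
theorem homotopic_of_homotopic {x y z : L _⦋1⦌} (hx : L.Homotopic x z) (hy : L.Homotopic y z) :
    L.Homotopic y x := by
  have hd := hx.1 0
  rw [homotopic_iff_isComposite] at hx hy ⊢
  rw [hd]
  refine hx.assoc ?_ hy
  simpa using isComposite_id (L.σ 0 (L.δ 0 z))

theorem Homotopic.symm {x y : L _⦋1⦌} (h : L.Homotopic x y) : L.Homotopic y x :=
  homotopic_of_homotopic h (homotopic_refl y)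

theorem Homotopic.trans {x y z : L _⦋1⦌} (h : L.Homotopic x y) (h' : L.Homotopic y z) :
    L.Homotopic x z :=
  homotopic_of_homotopic h'.symm h

theorem homotopic_equivalence : _root_.Equivalence fun x y : L _⦋1⦌ => L.Homotopic x y :=
  ⟨homotopic_refl, Homotopic.symm, Homotopic.trans⟩

theorem edgeClass_eq_iff {x y : L _⦋1⦌} : L.edgeClass x = L.edgeClass y ↔ L.Homotopic x y :=
  ⟨fun h => homotopic_equivalence.eqvGen_iff.1 (Quot.eqvGen_exact h), fun h => Quot.sound h⟩

/-- With the homotopies read as `x = x' ∘ 1` and `y = y' ∘ 1`, one reassociation replaces `x` by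
`x'`, and a second one exhibits `z` as `z' ∘ 1`. -/
theorem IsComposite.homotopic {x y z x' y' z' : L _⦋1⦌} (h : L.IsComposite x y z)
    (h' : L.IsComposite x' y' z') (hx : L.Homotopic x x') (hy : L.Homotopic y y') :
    L.Homotopic z z' := by
  have h₁ : L.IsComposite x' y z := by
    refine (homotopic_iff_isComposite.1 hx).assoc' ?_ h
    rw [← hx.1 0, h.boundary.1]
    exact id_isComposite y
  rw [homotopic_iff_isComposite, h'.boundary.2.1]
  exact h'.assoc (homotopic_iff_isComposite.1 hy) h₁

theorem homotopic₂_of_homotopic {x y z : L _⦋2⦌} (hx : L.Homotopic x z) (hy : L.Homotopic y z) :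
    L.Homotopic y x := by
  have f₀ : L.δ 0 x = L.δ 0 z := hx.1 0
  have f₁ : L.δ 1 x = L.δ 1 z := hx.1 1
  have g₀ : L.δ 0 y = L.δ 0 z := hy.1 0
  have g₁ : L.δ 1 y = L.δ 1 z := hy.1 1
  rw [homotopic_triangle_iff] at hx hy ⊢
  obtain ⟨γ₄, a₀, a₁, a₂, a₃⟩ := hx
  obtain ⟨γ₃, b₀, b₁, b₂, b₃⟩ := hy
  obtain ⟨Γ, h₀, h₁, h₃, h₄⟩ := KanComplex.exists_filler₄₂ (L.σ 2 (L.σ 1 (L.δ 0 z)))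
    (L.σ 2 (L.σ 1 (L.δ 1 z))) γ₃ γ₄ (by simp) (by simp [b₀, g₀]) (by simp [a₀, f₀])
    (by simp [b₁, g₁]) (by simp [a₁, f₁]) (by rw [a₃, b₃])
  exact ⟨L.δ 2 Γ, by simp [h₀, g₀], by simp [h₁, g₁], by rw [← δ₄23, h₃, b₂],
    by rw [← δ₄24, h₄, a₂]⟩

theorem homotopic₂_equivalence : _root_.Equivalence fun x y : L _⦋2⦌ => L.Homotopic x y :=
  ⟨homotopic₂_refl, fun h => homotopic₂_of_homotopic h (homotopic₂_refl _),
    fun h h' => homotopic₂_of_homotopic (homotopic₂_of_homotopic h' (homotopic₂_refl _)) h⟩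

omit [KanComplex L] in
theorem δ_constSimplex (n : ℕ) (i : Fin (n + 2)) (a : L _⦋0⦌) :
    L.δ i (L.constSimplex (n + 1) a) = L.constSimplex n a := by
  unfold constSimplex SimplicialObject.δ
  rw [← Functor.map_comp_apply]
  rfl

omit [KanComplex L] in
theorem constSimplex_one (a : L _⦋0⦌) : L.constSimplex 1 a = L.σ 0 a :=
  congrArg (fun f : ⦋1⦌ ⟶ ⦋0⦌ => L.map f.op a) (SimplexCategory.isTerminalZero.hom_ext _ _)

omit [KanComplex L] in
theorem constSimplex_two (a : L _⦋0⦌) : L.constSimplex 2 a = L.σ 1 (L.σ 0 a) := by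
  unfold SimplicialObject.σ
  rw [← Functor.map_comp_apply]
  exact congrArg (fun f : ⦋2⦌ ⟶ ⦋0⦌ => L.map f.op a) (SimplexCategory.isTerminalZero.hom_ext _ _)

theorem homotopic_of_sphere {a : L _⦋0⦌} (hπ : Subsingleton (L.PiSucc 1 a)) {w : L _⦋2⦌}
    (h₀ : L.δ 0 w = L.σ 0 a) (h₁ : L.δ 1 w = L.σ 0 a) (h₂ : L.δ 2 w = L.σ 0 a) :
    L.Homotopic (L.σ 1 (L.σ 0 a)) w := by
  let X := {x : L _⦋2⦌ // ∀ i : Fin 3, L.δ i x = L.constSimplex 1 a}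
  let w' : X := ⟨w, fun i => by
    rw [constSimplex_one]
    fin_cases i <;> assumption⟩
  let c : X := ⟨L.constSimplex 2 a, fun i => δ_constSimplex 1 i a⟩
  -- Equality in the quotient gives only the generated equivalence relation, which is homotopy
  -- itself by `homotopic₂_equivalence`.
  have h : Relation.EqvGen (fun x x' : X => L.Homotopic x.1 x'.1) c w' :=
    Quot.eqvGen_exact (hπ.elim (Quot.mk _ c) (Quot.mk _ w'))
  rw [← constSimplex_two]
  exact (homotopic₂_equivalence.comap fun x : X => x.1).eqvGen_iff.1 h

/-- The 3-horn with faces `s_1 e, s_1 e, w` measures the difference of `s_1 e` and `w` by its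
missing face 0, all of whose edges are degenerate on one vertex. That face is null-homotopic, and a
4-horn transports the null-homotopy back to `w`. -/
theorem homotopic_of_face_degenerate {e : L _⦋1⦌} (hπ : Subsingleton (L.PiSucc 1 (L.δ 0 e)))
    {w : L _⦋2⦌} (h₀ : L.δ 0 w = L.σ 0 (L.δ 0 e)) (h₁ : L.δ 1 w = e) (h₂ : L.δ 2 w = e) :
    L.Homotopic (L.σ 1 e) w := by
  obtain ⟨γ₄, a₁, a₂, a₃⟩ := KanComplex.exists_filler₃₀ (L.σ 1 e) (L.σ 1 e) w (by simp)
    (by simp [h₁]) (by simp [h₂])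
  have hw : L.Homotopic (L.σ 1 (L.σ 0 (L.δ 0 e))) (L.δ 0 γ₄) := by
    apply homotopic_of_sphere hπ
    · rw [← δ₃01, a₁]; simp
    · rw [← δ₃02, a₂]; simp
    · rw [← δ₃03, a₃, h₀]
  obtain ⟨γ₀, b₀, b₁, b₂, b₃⟩ := homotopic_triangle_iff.1 hw
  obtain ⟨Γ, k₀, k₁, k₂, k₄⟩ := KanComplex.exists_filler₄₃ γ₀ (L.σ 2 (L.σ 1 e)) (L.σ 2 (L.σ 1 e)) γ₄
    (by simp [b₀]) (by simp [b₁]) b₃.symm (by simp) (by simp [a₁]) (by simp [a₂])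
  refine homotopic_triangle_iff.2 ⟨L.δ 3 Γ, ?_, ?_, ?_, ?_⟩
  · simp [k₀, b₂]
  · simp [k₁]
  · simp [k₂]
  · rw [← δ₄34, k₄, a₃]

/-- If the second homotopy groups vanish, two `2`-simplices with the same boundary are homotopic. -/
theorem homotopic_of_δ_eq (hπ : ∀ a : L _⦋0⦌, Subsingleton (L.PiSucc 1 a)) {x x' : L _⦋2⦌}
    (h₀ : L.δ 0 x = L.δ 0 x') (h₁ : L.δ 1 x = L.δ 1 x') (h₂ : L.δ 2 x = L.δ 2 x') :
    L.Homotopic x x' := by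
  -- The missing face 0 is the difference of `x` and `x'`. Its edges are `s_0 d_0 e, e, e` with `e =
  -- d_0 x`, hence the previous case applies.
  obtain ⟨γ₄, a₁, a₂, a₃⟩ := KanComplex.exists_filler₃₀ (L.σ 1 (L.δ 1 x)) x x' (by simp)
    (by simp [h₁]) h₂.symm
  have hw : L.Homotopic (L.σ 1 (L.δ 0 x)) (L.δ 0 γ₄) := by
    apply homotopic_of_face_degenerate (hπ _)
    · rw [← δ₃01, a₁]; simp
    · rw [← δ₃02, a₂]
    · rw [← δ₃03, a₃, h₀]
  obtain ⟨γ₀, b₀, b₁, b₂, b₃⟩ := homotopic_triangle_iff.1 hw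
  -- Face 3 of the filler is `γ₄` with its face 0 replaced by the degenerate simplex to which it is
  -- homotopic.
  obtain ⟨Γ, k₀, k₁, k₂, k₄⟩ := KanComplex.exists_filler₄₃ γ₀ (L.σ 2 (L.σ 1 (L.δ 1 x))) (L.σ 2 x) γ₄
    (by simp [b₀]) (by simp [b₁]) b₃.symm (by simp) (by simp [a₁]) (by simp [a₂])
  refine homotopic_triangle_iff.2 ⟨L.δ 3 Γ, ?_, ?_, ?_, ?_⟩
  · simp [k₀, b₂]
  · simp [k₁]
  · simp [k₂]
  · rw [← δ₄34, k₄, a₃]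

end SSet

/-! ### Bisimplicial identities and bihorn fillers -/

namespace BiSSet

variable {K : BiSSet.{u}}

section Identities

variable {p q : ℕ}

@[simp] theorem dh_dv (i : Fin (p + 2)) (j : Fin (q + 2)) (x : K.cell (p + 1) (q + 1)) :
    K.dh i (K.dv j x) = K.dv j (K.dh i x) :=
  SSet.δ_naturality_apply (K.map (SimplexCategory.δ i).op) j x

@[simp] theorem dh_sv (i : Fin (p + 2)) (j : Fin (q + 1)) (x : K.cell (p + 1) q) :
    K.dh i (K.sv j x) = K.sv j (K.dh i x) :=
  SSet.σ_naturality_apply (K.map (SimplexCategory.δ i).op) j x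

@[simp] theorem dv_sh (i : Fin (p + 1)) (j : Fin (q + 2)) (x : K.cell p (q + 1)) :
    K.dv j (K.sh i x) = K.sh i (K.dv j x) :=
  (SSet.δ_naturality_apply (K.map (SimplexCategory.σ i).op) j x).symm

theorem sh_sv (i : Fin (p + 1)) (j : Fin (q + 1)) (x : K.cell p q) :
    K.sh i (K.sv j x) = K.sv j (K.sh i x) :=
  SSet.σ_naturality_apply (K.map (SimplexCategory.σ i).op) j x

@[simp] theorem dh01 (x : K.cell 2 q) : K.dh 0 (K.dh 1 x) = K.dh 0 (K.dh 0 x) := SSet.δ01 _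
@[simp] theorem dh02 (x : K.cell 2 q) : K.dh 0 (K.dh 2 x) = K.dh 1 (K.dh 0 x) := SSet.δ02 _
@[simp] theorem dh12 (x : K.cell 2 q) : K.dh 1 (K.dh 2 x) = K.dh 1 (K.dh 1 x) := SSet.δ12 _
@[simp] theorem dh0_sh (x : K.cell 0 q) : K.dh 0 (K.sh 0 x) = x := SSet.δ₁0σ _
@[simp] theorem dh1_sh (x : K.cell 0 q) : K.dh 1 (K.sh 0 x) = x := SSet.δ₁1σ _
@[simp] theorem dh0_sh0 (x : K.cell 1 q) : K.dh 0 (K.sh 0 x) = x := SSet.δ₂0σ0 _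
@[simp] theorem dh1_sh0 (x : K.cell 1 q) : K.dh 1 (K.sh 0 x) = x := SSet.δ₂1σ0 _
@[simp] theorem dh2_sh0 (x : K.cell 1 q) : K.dh 2 (K.sh 0 x) = K.sh 0 (K.dh 1 x) := SSet.δ₂2σ0 _
@[simp] theorem dh0_sh1 (x : K.cell 1 q) : K.dh 0 (K.sh 1 x) = K.sh 0 (K.dh 0 x) := SSet.δ₂0σ1 _
@[simp] theorem dh1_sh1 (x : K.cell 1 q) : K.dh 1 (K.sh 1 x) = x := SSet.δ₂1σ1 _
@[simp] theorem dh2_sh1 (x : K.cell 1 q) : K.dh 2 (K.sh 1 x) = x := SSet.δ₂2σ1 _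

@[simp] theorem dv01 (x : K.cell p 2) : K.dv 0 (K.dv 1 x) = K.dv 0 (K.dv 0 x) := SSet.δ01 _
@[simp] theorem dv03 (x : K.cell p 3) : K.dv 0 (K.dv 3 x) = K.dv 2 (K.dv 0 x) := SSet.δ₃03 _
@[simp] theorem dv13 (x : K.cell p 3) : K.dv 1 (K.dv 3 x) = K.dv 2 (K.dv 1 x) := SSet.δ₃13 _
@[simp] theorem dv23 (x : K.cell p 3) : K.dv 2 (K.dv 3 x) = K.dv 2 (K.dv 2 x) := SSet.δ₃23 _
@[simp] theorem dv0_sv (x : K.cell p 0) : K.dv 0 (K.sv 0 x) = x := SSet.δ₁0σ _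
@[simp] theorem dv0_sv1 (x : K.cell p 1) : K.dv 0 (K.sv 1 x) = K.sv 0 (K.dv 0 x) := SSet.δ₂0σ1 _
@[simp] theorem dv1_sv1 (x : K.cell p 1) : K.dv 1 (K.sv 1 x) = x := SSet.δ₂1σ1 _
@[simp] theorem dv2_sv1 (x : K.cell p 1) : K.dv 2 (K.sv 1 x) = x := SSet.δ₂2σ1 _

end Identities

theorem ExtensionCondition.flip (hK : K.ExtensionCondition) :
    ExtensionCondition (Functor.flip K) where
  vert_kan := hK.horiz_kan
  horiz_kan := hK.vert_kan
  bihorn p q k l x x' h := by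
    obtain ⟨z, h₁, h₂⟩ := hK.bihorn q p l k x' x
      ⟨h.vert_match, h.horiz_match, fun i hi j hj => (h.mixed_match j hj i hi).symm⟩
    exact ⟨z, h₂, h₁⟩

section Fillers

theorem ExtensionCondition.exists_filler₁₁ (hK : K.ExtensionCondition) (x₀ : K.cell 0 1)
    (y₁ : K.cell 1 0) (h : K.dh 0 y₁ = K.dv 1 x₀) :
    ∃ z : K.cell 1 1, K.dh 0 z = x₀ ∧ K.dv 1 z = y₁ := by
  obtain ⟨z, hz, hz'⟩ := hK.bihorn 0 0 1 0 (fun i _ => ![x₀, x₀] i) (fun j _ => ![y₁, y₁] j)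
    ⟨trivial, trivial, by
      intro i hi j hj
      fin_cases i <;> fin_cases j <;> first | contradiction | assumption⟩
  exact ⟨z, hz 0 (by decide), hz' 1 (by decide)⟩

theorem ExtensionCondition.exists_filler₁₂ (hK : K.ExtensionCondition) (x₀ : K.cell 0 2)
    (y₀ y₁ : K.cell 1 1) (h : K.dv 0 y₁ = K.dv 0 y₀) (h₀ : K.dh 0 y₀ = K.dv 0 x₀)
    (h₁ : K.dh 0 y₁ = K.dv 1 x₀) :
    ∃ z : K.cell 1 2, K.dh 0 z = x₀ ∧ K.dv 0 z = y₀ ∧ K.dv 1 z = y₁ := by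
  obtain ⟨z, hz, hz'⟩ := hK.bihorn 0 1 1 2 (fun i _ => ![x₀, x₀] i) (fun j _ => ![y₀, y₁, y₁] j)
    ⟨trivial, by
      intro i j hi hj hij
      fin_cases i <;> fin_cases j <;> first | contradiction | assumption, by
      intro i hi j hj
      fin_cases i <;> fin_cases j <;> first | contradiction | assumption⟩
  exact ⟨z, hz 0 (by decide), hz' 0 (by decide), hz' 1 (by decide)⟩

theorem ExtensionCondition.exists_filler₁₂' (hK : K.ExtensionCondition) (x₀ : K.cell 0 2)
    (y₀ y₂ : K.cell 1 1) (h : K.dv 0 y₂ = K.dv 1 y₀) (h₀ : K.dh 0 y₀ = K.dv 0 x₀)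
    (h₂ : K.dh 0 y₂ = K.dv 2 x₀) :
    ∃ z : K.cell 1 2, K.dh 0 z = x₀ ∧ K.dv 0 z = y₀ ∧ K.dv 2 z = y₂ := by
  obtain ⟨z, hz, hz'⟩ := hK.bihorn 0 1 1 1 (fun i _ => ![x₀, x₀] i) (fun j _ => ![y₀, y₂, y₂] j)
    ⟨trivial, by
      intro i j hi hj hij
      fin_cases i <;> fin_cases j <;> first | contradiction | assumption, by
      intro i hi j hj
      fin_cases i <;> fin_cases j <;> first | contradiction | assumption⟩
  exact ⟨z, hz 0 (by decide), hz' 0 (by decide), hz' 2 (by decide)⟩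

theorem ExtensionCondition.exists_filler₁₃ (hK : K.ExtensionCondition) (x₁ : K.cell 0 3)
    (y₀ y₁ y₂ : K.cell 1 2) (h₀₁ : K.dv 0 y₁ = K.dv 0 y₀) (h₀₂ : K.dv 0 y₂ = K.dv 1 y₀)
    (h₁₂ : K.dv 1 y₂ = K.dv 1 y₁) (h₀ : K.dh 1 y₀ = K.dv 0 x₁) (h₁ : K.dh 1 y₁ = K.dv 1 x₁)
    (h₂ : K.dh 1 y₂ = K.dv 2 x₁) :
    ∃ z : K.cell 1 3, K.dh 1 z = x₁ ∧ K.dv 0 z = y₀ ∧ K.dv 1 z = y₁ ∧ K.dv 2 z = y₂ := by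
  obtain ⟨z, hz, hz'⟩ := hK.bihorn 0 2 0 3 (fun i _ => ![x₁, x₁] i)
    (fun j _ => ![y₀, y₁, y₂, y₂] j)
    ⟨trivial, by
      intro i j hi hj hij
      fin_cases i <;> fin_cases j <;> first | contradiction | assumption, by
      intro i hi j hj
      fin_cases i <;> fin_cases j <;> first | contradiction | assumption⟩
  exact ⟨z, hz 1 (by decide), hz' 0 (by decide), hz' 1 (by decide), hz' 2 (by decide)⟩

theorem ExtensionCondition.exists_filler₂₂ (hK : K.ExtensionCondition) (x₀ x₂ : K.cell 1 2)
    (y₀ y₁ : K.cell 2 1) (hx : K.dh 0 x₂ = K.dh 1 x₀) (hy : K.dv 0 y₁ = K.dv 0 y₀)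
    (h₀₀ : K.dh 0 y₀ = K.dv 0 x₀) (h₀₁ : K.dh 0 y₁ = K.dv 1 x₀)
    (h₂₀ : K.dh 2 y₀ = K.dv 0 x₂) (h₂₁ : K.dh 2 y₁ = K.dv 1 x₂) :
    ∃ z : K.cell 2 2, K.dh 0 z = x₀ ∧ K.dh 2 z = x₂ ∧ K.dv 0 z = y₀ ∧ K.dv 1 z = y₁ := by
  obtain ⟨z, hz, hz'⟩ := hK.bihorn 1 1 1 2 (fun i _ => ![x₀, x₀, x₂] i)
    (fun j _ => ![y₀, y₁, y₁] j)
    ⟨by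
      intro i j hi hj hij
      fin_cases i <;> fin_cases j <;> first | contradiction | assumption, by
      intro i j hi hj hij
      fin_cases i <;> fin_cases j <;> first | contradiction | assumption, by
      intro i hi j hj
      fin_cases i <;> fin_cases j <;> first | contradiction | assumption⟩
  exact ⟨z, hz 0 (by decide), hz 2 (by decide), hz' 0 (by decide), hz' 1 (by decide)⟩

theorem ExtensionCondition.exists_filler₂₂' (hK : K.ExtensionCondition) (x₀ x₂ : K.cell 1 2)
    (y₀ y₂ : K.cell 2 1) (hx : K.dh 0 x₂ = K.dh 1 x₀) (hy : K.dv 0 y₂ = K.dv 1 y₀)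
    (h₀₀ : K.dh 0 y₀ = K.dv 0 x₀) (h₀₂ : K.dh 0 y₂ = K.dv 2 x₀)
    (h₂₀ : K.dh 2 y₀ = K.dv 0 x₂) (h₂₂ : K.dh 2 y₂ = K.dv 2 x₂) :
    ∃ z : K.cell 2 2, K.dh 0 z = x₀ ∧ K.dh 2 z = x₂ ∧ K.dv 0 z = y₀ ∧ K.dv 2 z = y₂ := by
  obtain ⟨z, hz, hz'⟩ := hK.bihorn 1 1 1 1 (fun i _ => ![x₀, x₀, x₂] i)
    (fun j _ => ![y₀, y₀, y₂] j)
    ⟨by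
      intro i j hi hj hij
      fin_cases i <;> fin_cases j <;> first | contradiction | assumption, by
      intro i j hi hj hij
      fin_cases i <;> fin_cases j <;> first | contradiction | assumption, by
      intro i hi j hj
      fin_cases i <;> fin_cases j <;> first | contradiction | assumption⟩
  exact ⟨z, hz 0 (by decide), hz 2 (by decide), hz' 0 (by decide), hz' 2 (by decide)⟩

end Fillers

theorem homotopicH_iff {q : ℕ} {x x' : K.cell 1 q} :
    K.HomotopicH x x' ↔
      ∃ y : K.cell 2 q, K.dh 0 y = K.sh 0 (K.dh 0 x) ∧ K.dh 1 y = x ∧ K.dh 2 y = x' :=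
  SSet.homotopic_edge_iff

theorem homotopicV_iff {p : ℕ} {x x' : K.cell p 1} :
    K.HomotopicV x x' ↔
      ∃ y : K.cell p 2, K.dv 0 y = K.sv 0 (K.dv 0 x) ∧ K.dv 1 y = x ∧ K.dv 2 y = x' :=
  SSet.homotopic_edge_iff

theorem HomotopicH.dh_eq {q : ℕ} {x x' : K.cell 1 q} (h : K.HomotopicH x x') (i : Fin 2) :
    K.dh i x = K.dh i x' := h.1 i

theorem HomotopicV.dv_eq {p : ℕ} {x x' : K.cell p 1} (h : K.HomotopicV x x') (j : Fin 2) :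
    K.dv j x = K.dv j x' := h.1 j

theorem HomotopicV.dh {p : ℕ} {x x' : K.cell (p + 1) 1} (h : K.HomotopicV x x')
    (i : Fin (p + 2)) : K.HomotopicV (K.dh i x) (K.dh i x') := by
  obtain ⟨y, h₀, rfl, rfl⟩ := homotopicV_iff.1 h
  exact homotopicV_iff.2 ⟨K.dh i y, by rw [← dh_dv, h₀]; simp, by simp, by simp⟩

theorem HomotopicV.sh {p : ℕ} {x x' : K.cell p 1} (h : K.HomotopicV x x')
    (i : Fin (p + 1)) : K.HomotopicV (K.sh i x) (K.sh i x') := by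
  obtain ⟨y, h₀, rfl, rfl⟩ := homotopicV_iff.1 h
  exact homotopicV_iff.2 ⟨K.sh i y, by rw [dv_sh, h₀]; simp [sh_sv], by simp, by simp⟩

/-! ### Bihomotopy, invariance of composites, and grids of squares -/

namespace ExtensionCondition

variable (hK : K.ExtensionCondition)

include hK

theorem homotopicH_equivalence (q : ℕ) :
    _root_.Equivalence fun x y : K.cell 1 q => K.HomotopicH x y :=
  have := hK.horiz_kan q
  SSet.homotopic_equivalence (L := K.horiz q)

theorem homotopicV_equivalence (p : ℕ) :
    _root_.Equivalence fun x y : K.cell p 1 => K.HomotopicV x y :=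
  have := hK.vert_kan p
  SSet.homotopic_equivalence (L := K.vert p)

theorem homotopicV_homotopicH {x y x' : K.cell 1 1} (hxy : K.HomotopicH x y)
    (hyx' : K.HomotopicV y x') : ∃ z : K.cell 1 1, K.HomotopicV x z ∧ K.HomotopicH z x' := by
  have e := hxy.dh_eq 0
  obtain ⟨γ, a₀, rfl, a₂⟩ := homotopicH_iff.1 hxy
  obtain ⟨δ, b₀, b₁, rfl⟩ := homotopicV_iff.1 hyx'
  have c₀ : K.dv 0 (K.dh 0 δ) = K.sv 0 (K.dv 0 (K.dh 0 y)) := by rw [← dh_dv, b₀]; simp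
  have c₁ : K.dv 1 (K.dh 0 δ) = K.dh 0 y := by rw [← dh_dv, b₁]
  obtain ⟨z, h₀, h₂, k₀, k₁⟩ := hK.exists_filler₂₂ (K.sh 0 (K.dh 0 δ)) δ (K.sv 0 (K.dv 0 γ)) γ
    (by simp) (by simp) (by rw [dh_sv, dh_dv, a₀, e, dv_sh, dv_sh, c₀, sh_sv])
    (by rw [dv_sh, c₁, a₀, e]) (by rw [dh_sv, dh_dv, a₂, b₀]) (by rw [a₂, b₁])
  refine ⟨K.dh 1 (K.dv 2 z), ?_, ?_⟩
  · refine homotopicV_iff.2 ⟨K.dh 1 z, ?_, ?_, ?_⟩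
    · rw [← dh_dv, k₀]; simp
    · rw [← dh_dv, k₁]
    · simp
  · refine homotopicH_iff.2 ⟨K.dv 2 z, ?_, ?_, ?_⟩
    · simp [h₀]
    · rfl
    · simp [h₂]

theorem homotopicH_homotopicV {x y x' : K.cell 1 1} (hxy : K.HomotopicV x y)
    (hyx' : K.HomotopicH y x') : ∃ z : K.cell 1 1, K.HomotopicH x z ∧ K.HomotopicV z x' :=
  hK.flip.homotopicV_homotopicH hxy hyx'

theorem bihomotopic_equivalence :
    _root_.Equivalence fun x y : K.cell 1 1 => K.Bihomotopic x y where
  refl x := ⟨x, (hK.homotopicH_equivalence 1).refl x, (hK.homotopicV_equivalence 1).refl x⟩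
  symm := fun ⟨_, h, h'⟩ => hK.homotopicH_homotopicV ((hK.homotopicV_equivalence 1).symm h')
    ((hK.homotopicH_equivalence 1).symm h)
  trans := fun ⟨_, h₁, h₁'⟩ ⟨_, h₂, h₂'⟩ => by
    obtain ⟨w, h, h'⟩ := hK.homotopicH_homotopicV h₁' h₂
    exact ⟨w, (hK.homotopicH_equivalence 1).trans h₁ h,
      (hK.homotopicV_equivalence 1).trans h' h₂'⟩

theorem bihomotopic_flip_iff {x y : K.cell 1 1} :
    Bihomotopic (Functor.flip K) (p := 0) (q := 0) x y ↔ K.Bihomotopic x y :=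
  ⟨fun ⟨_, h, h'⟩ => hK.homotopicH_homotopicV h h',
    fun ⟨_, h, h'⟩ => hK.homotopicV_homotopicH h h'⟩

theorem _root_.BiSSet.HomotopicV.bihomotopic {x y : K.cell 1 1} (h : K.HomotopicV x y) :
    K.Bihomotopic x y :=
  ⟨x, (hK.homotopicH_equivalence 1).refl x, h⟩

theorem _root_.BiSSet.HomotopicH.bihomotopic {x y : K.cell 1 1} (h : K.HomotopicH x y) :
    K.Bihomotopic x y :=
  ⟨y, h, (hK.homotopicV_equivalence 1).refl y⟩

/-- A vertical homotopy of the horizontal source extends to a vertical homotopy. -/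
theorem exists_homotopicV_dh_eq {x : K.cell 1 1} {u : K.cell 0 1}
    (h : K.HomotopicV (K.dh 0 x) u) : ∃ x' : K.cell 1 1, K.HomotopicV x x' ∧ K.dh 0 x' = u := by
  obtain ⟨θ, a₀, a₁, rfl⟩ := homotopicV_iff.1 h
  -- Homotopy extension: `θ` is the prescribed homotopy on the edge, and the missing face `dv 2` is
  -- the deformed square.
  obtain ⟨z, h₀, k₀, k₁⟩ := hK.exists_filler₁₂ θ (K.sv 0 (K.dv 0 x)) x (by simp)
    (by rw [dh_sv, dh_dv, a₀]) a₁.symm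
  exact ⟨K.dv 2 z, homotopicV_iff.2 ⟨z, k₀, k₁, rfl⟩, by rw [dh_dv, h₀]⟩

theorem exists_homotopicH_dv_eq {x : K.cell 1 1} {f : K.cell 1 0}
    (h : K.HomotopicH (K.dv 0 x) f) : ∃ x' : K.cell 1 1, K.HomotopicH x x' ∧ K.dv 0 x' = f :=
  hK.flip.exists_homotopicV_dh_eq h

/-- Two fillings of the same triangle in `K_{0,*}` are homotopic because the second homotopy groups
vanish. Extending that homotopy over a (1,3)-bihorn on `φ` swaps one filling for the other without
moving the vertical faces. -/
theorem exists_dv_eq_dh_eq (hπ : ∀ a : K.cell 0 0, Subsingleton ((K.vert 0).PiSucc 1 a))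
    (φ : K.cell 1 2) (τ : K.cell 0 2) (h : ∀ j : Fin 3, K.dv j (K.dh 1 φ) = K.dv j τ) :
    ∃ φ' : K.cell 1 2, (∀ j : Fin 3, K.dv j φ' = K.dv j φ) ∧ K.dh 1 φ' = τ := by
  have := hK.vert_kan 0
  obtain ⟨y, a₀, a₁, a₂, a₃⟩ := SSet.homotopic_triangle_iff.1
    (SSet.homotopic_of_δ_eq (L := K.vert 0) hπ (h 0) (h 1) (h 2))
  change K.dv 0 y = K.sv 1 (K.dv 0 (K.dh 1 φ)) at a₀
  change K.dv 1 y = K.sv 1 (K.dv 1 (K.dh 1 φ)) at a₁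
  change K.dv 2 y = K.dh 1 φ at a₂
  change K.dv 3 y = τ at a₃
  obtain ⟨z, h₁, k₀, k₁, k₂⟩ := hK.exists_filler₁₃ y (K.sv 1 (K.dv 0 φ)) (K.sv 1 (K.dv 1 φ)) φ
    (by simp) (by simp) (by simp) (by rw [a₀]; simp) (by rw [a₁]; simp) a₂.symm
  refine ⟨K.dv 3 z, fun j => ?_, by rw [dh_dv, h₁, a₃]⟩
  fin_cases j
  · exact (dv03 z).trans (by rw [k₀, dv2_sv1]; rfl)
  · exact (dv13 z).trans (by rw [k₁, dv2_sv1]; rfl)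
  · exact (dv23 z).trans (by rw [k₂]; rfl)

/-- Horizontal composites are invariant under vertical homotopy. -/
theorem exists_homotopicV_composite
    (hπ : ∀ a : K.cell 0 0, Subsingleton ((K.vert 0).PiSucc 1 a))
    {γ : K.cell 2 1} {a b : K.cell 1 1} (ha : K.HomotopicV (K.dh 2 γ) a)
    (hb : K.HomotopicV (K.dh 0 γ) b) (hab : K.dh 0 a = K.dh 1 b) :
    ∃ γ' : K.cell 2 1, K.dh 2 γ' = a ∧ K.dh 0 γ' = b ∧
      K.HomotopicV (K.dh 1 γ) (K.dh 1 γ') := by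
  obtain ⟨θ, a₀, a₁, a₂⟩ := homotopicV_iff.1 ha
  obtain ⟨φ, b₀, b₁, b₂⟩ := homotopicV_iff.1 hb
  -- The two homotopies need not agree on the common edge; `φ` is changed so that they do and can be
  -- pasted along `γ`.
  obtain ⟨φ', hφ, hφ'⟩ := hK.exists_dv_eq_dh_eq hπ φ (K.dh 0 θ) (fun j => by
    fin_cases j
    · change K.dv 0 (K.dh 1 φ) = K.dv 0 (K.dh 0 θ)
      rw [← dh_dv, ← dh_dv, a₀, b₀]; simp
    · change K.dv 1 (K.dh 1 φ) = K.dv 1 (K.dh 0 θ)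
      rw [← dh_dv, ← dh_dv, a₁, b₁]; simp
    · change K.dv 2 (K.dh 1 φ) = K.dv 2 (K.dh 0 θ)
      rw [← dh_dv, ← dh_dv, a₂, b₂, hab])
  obtain ⟨z, h₀, h₂, k₀, k₁⟩ := hK.exists_filler₂₂ φ' θ (K.sv 0 (K.dv 0 γ)) γ hφ'.symm (by simp)
    (by rw [hφ, b₀]; simp) (by rw [hφ, b₁]) (by rw [a₀]; simp) a₁.symm
  refine ⟨K.dv 2 z, by rw [dh_dv, h₂, a₂], by rw [dh_dv, h₀, hφ, b₂], ?_⟩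
  refine homotopicV_iff.2 ⟨K.dh 1 z, ?_, ?_, ?_⟩
  · rw [← dh_dv, k₀]; simp
  · rw [← dh_dv, k₁]
  · simp

/-- The horizontal halves of the bihomotopies are handled inside the Kan complex `K_{*,1}`, the
vertical halves by `exists_homotopicV_composite`. The intermediate squares `a`, `b` are strictly
composable since horizontal homotopies fix horizontal faces. -/
theorem bihomotopic_composite (hπ : ∀ a : K.cell 0 0, Subsingleton ((K.vert 0).PiSucc 1 a))
    {γ γ' : K.cell 2 1} (h₂ : K.Bihomotopic (K.dh 2 γ) (K.dh 2 γ'))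
    (h₀ : K.Bihomotopic (K.dh 0 γ) (K.dh 0 γ')) : K.Bihomotopic (K.dh 1 γ) (K.dh 1 γ') := by
  obtain ⟨a, ha, ha'⟩ := h₂
  obtain ⟨b, hb, hb'⟩ := h₀
  have := hK.horiz_kan 1
  have hc : SSet.IsComposite (K.horiz 1) (K.dh 2 γ) (K.dh 0 γ) (K.dh 1 γ) := ⟨γ, rfl, rfl, rfl⟩
  have hc' : SSet.IsComposite (K.horiz 1) (K.dh 2 γ') (K.dh 0 γ') (K.dh 1 γ') :=
    ⟨γ', rfl, rfl, rfl⟩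
  obtain ⟨c, hab⟩ := SSet.exists_isComposite (L := K.horiz 1) (x := a) (y := b)
    ((ha.1 0).symm.trans (hc.boundary.1.trans (hb.1 1)))
  have h₁ : K.HomotopicH (K.dh 1 γ) c := hc.homotopic hab ha hb
  obtain ⟨δ, rfl, rfl, rfl⟩ := hab
  obtain ⟨δ', e, e', h₂⟩ := hK.exists_homotopicV_composite hπ ha' hb' hc'.boundary.1
  have h₃ : K.HomotopicH (K.dh 1 δ') (K.dh 1 γ') :=
    SSet.IsComposite.homotopic (L := K.horiz 1) ⟨δ', e, e', rfl⟩ hc'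
      (SSet.homotopic_refl _) (SSet.homotopic_refl _)
  have E := hK.bihomotopic_equivalence
  exact E.trans (h₁.bihomotopic hK) (E.trans (h₂.bihomotopic hK) (h₃.bihomotopic hK))

/-- Four bisimplices whose boundary classes match in a `2 × 2` grid are, up to bihomotopy, the
corners of a `(2,2)`-bisimplex. -/
theorem exists_grid {a b c d : K.cell 1 1} (hab : K.HomotopicV (K.dh 0 a) (K.dh 1 b))
    (hcd : K.HomotopicV (K.dh 0 c) (K.dh 1 d)) (hac : K.HomotopicH (K.dv 0 a) (K.dv 1 c))
    (hbd : K.HomotopicH (K.dv 0 b) (K.dv 1 d)) :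
    ∃ z : K.cell 2 2, K.Bihomotopic a (K.dh 2 (K.dv 2 z)) ∧
      K.Bihomotopic b (K.dh 0 (K.dv 2 z)) ∧ K.Bihomotopic c (K.dh 2 (K.dv 0 z)) ∧
      K.Bihomotopic d (K.dh 0 (K.dv 0 z)) := by
  -- With `d` fixed, `b` and `c` are adjusted to meet it exactly, then `a` to meet both. The order
  -- is harmless: a horizontal homotopy keeps the faces `dh`, a vertical one keeps the faces `dv`,
  -- so no match is undone.
  obtain ⟨b', hb, hbd'⟩ := hK.exists_homotopicH_dv_eq hbd
  obtain ⟨c', hc, hcd'⟩ := hK.exists_homotopicV_dh_eq hcd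
  rw [hb.dh_eq 1] at hab
  rw [hc.dv_eq 1] at hac
  obtain ⟨a', ha, hab'⟩ := hK.exists_homotopicV_dh_eq hab
  rw [ha.dv_eq 0] at hac
  obtain ⟨a'', ha', hac'⟩ := hK.exists_homotopicH_dv_eq hac
  rw [ha'.dh_eq 0] at hab'
  have := hK.horiz_kan 1
  have := hK.vert_kan 1
  obtain ⟨ν, n₀, n₂⟩ := SSet.KanComplex.exists_filler₂₁ (L := K.horiz 1) d c' hcd'
  obtain ⟨ρ, r₀, r₂⟩ := SSet.KanComplex.exists_filler₂₁ (L := K.vert 1) d b' hbd'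
  change K.dh 0 ν = d at n₀
  change K.dh 2 ν = c' at n₂
  change K.dv 0 ρ = d at r₀
  change K.dv 2 ρ = b' at r₂
  obtain ⟨τ, t, t₀, t₂⟩ := hK.exists_filler₁₂' (K.dh 1 ρ) c' a'' hac'
    (by rw [← dh_dv, r₀, hcd']) (by rw [← dh_dv, r₂, hab'])
  obtain ⟨μ, m, m₀, m₂⟩ : ∃ μ : K.cell 2 1, K.dv 0 μ = K.dv 1 ν ∧ K.dh 0 μ = b' ∧ K.dh 2 μ = a'' :=
    hK.flip.exists_filler₁₂' (K.dv 1 ν) b' a'' hab'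
    (by change K.dv 0 b' = K.dh 0 (K.dv 1 ν); rw [dh_dv, n₀, hbd'])
    (by change K.dv 0 a'' = K.dh 2 (K.dv 1 ν); rw [dh_dv, n₂, hac'])
  -- The outer faces are composition witnesses for the four sides of the grid; the missing faces `dh
  -- 1` and `dv 1` will witness the composites of the composites.
  obtain ⟨z, h₀, h₂, k₀, k₂⟩ := hK.exists_filler₂₂' ρ τ ν μ t m (by rw [n₀, r₀])
    (by rw [m₀, r₂]) (by rw [n₂, t₀]) (by rw [m₂, t₂])
  have E := hK.bihomotopic_equivalence
  refine ⟨z, ?_, ?_, ?_, ?_⟩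
  · rw [k₂, m₂]; exact E.trans (ha.bihomotopic hK) (ha'.bihomotopic hK)
  · rw [k₂, m₀]; exact hb.bihomotopic hK
  · rw [k₀, n₂]; exact hc.bihomotopic hK
  · rw [k₀, n₀]; exact E.refl d

end ExtensionCondition

end BiSSet

/-! ### Categories from composition relations -/

namespace CatStr

variable {M O : Type u}

theorem ext_of_comp {S S' : CatStr M O} (hs : S.s = S'.s) (ht : S.t = S'.t) (hI : S.I = S'.I)
    (hc : ∀ f g h h', S.comp f g h = S'.comp f g h') : S = S' := by
  obtain ⟨s, t, I, comp, _, _, _, _, _, _, _⟩ := S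
  obtain ⟨s', t', I', comp', _, _, _, _, _, _, _⟩ := S'
  obtain rfl : s = s' := hs
  obtain rfl : t = t' := ht
  obtain rfl : I = I' := hI
  obtain rfl : comp = comp' := by
    funext f g h
    exact hc f g h h
  rfl

theorem isGroupoid_of_inverses {S : CatStr M O}
    (hr : ∀ f, ∃ (g : M) (h : S.s f = S.t g), S.comp f g h = S.I (S.t f))
    (hl : ∀ f, ∃ (g : M) (h : S.s g = S.t f), S.comp g f h = S.I (S.s f)) : S.IsGroupoid := by
  intro f
  obtain ⟨g, h, e⟩ := hr f
  obtain ⟨g', h', e'⟩ := hl f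
  obtain rfl : g' = g := by
    have h₁ := S.comp_I g'
    have h₂ := S.I_comp g
    have h₃ := S.assoc g' f g h' h
    simp only [e, e'] at h₃
    simp only [h'] at h₁
    simp only [← h] at h₂
    exact h₁.symm.trans (h₃.symm.trans h₂)
  exact ⟨g', h, h', e, e'⟩

/-- A category structure from a composition relation. -/
theorem exists_of_relation (s t : M → O) (I : O → M) (T : M → M → M → Prop)
    (s_I : ∀ a, s (I a) = a) (t_I : ∀ a, t (I a) = a)
    (bd : ∀ {f g k}, T f g k → s f = t g ∧ s k = s g ∧ t k = t f)
    (ex : ∀ {f g}, s f = t g → ∃ k, T f g k)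
    (uniq : ∀ {f g k k'}, T f g k → T f g k' → k = k')
    (T_I : ∀ f, T f (I (s f)) f) (I_T : ∀ f, T (I (t f)) f f)
    (assoc : ∀ {f g k}, s f = t g → s g = t k → ∃ p q r, T f g p ∧ T g k q ∧ T p k r ∧ T f q r)
    (inv : ∀ f, ∃ g, T f g (I (t f))) (inv' : ∀ f, ∃ g, T g f (I (s f))) :
    ∃ S : CatStr M O, S.s = s ∧ S.t = t ∧ S.I = I ∧
      (∀ f g k h, T f g k → S.comp f g h = k) ∧ S.IsGroupoid := by
  have key : ∀ {f g k} (h : s f = t g), T f g k → (ex h).choose = k :=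
    fun h hk => uniq (ex h).choose_spec hk
  let S : CatStr M O :=
    { s := s
      t := t
      I := I
      comp := fun f g h => (ex h).choose
      s_I := s_I
      t_I := t_I
      s_comp := fun f g h => (bd (ex h).choose_spec).2.1
      t_comp := fun f g h => (bd (ex h).choose_spec).2.2
      comp_I := fun f => key (t_I (s f)).symm (T_I f)
      I_comp := fun f => key (s_I (t f)) (I_T f)
      assoc := by
        intro f g k h₁ h₂
        obtain ⟨p, q, r, hp, hq, hr, hr'⟩ := assoc h₁ h₂
        have hp' := key h₁ hp
        have hq' := key h₂ hq
        simp only [hp', hq']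
        exact (key (bd hr).1 hr).trans (key (bd hr').1 hr').symm }
  refine ⟨S, rfl, rfl, rfl, fun f g k h => key h, isGroupoid_of_inverses (fun f => ?_) fun f => ?_⟩
  · obtain ⟨g, hg⟩ := inv f
    exact ⟨g, (bd hg).1, key (bd hg).1 hg⟩
  · obtain ⟨g, hg⟩ := inv' f
    exact ⟨g, (bd hg).1, key (bd hg).1 hg⟩

end CatStr

/-! ### The fundamental groupoid of a Kan complex -/

namespace SSet

variable {L : SSet.{u}}

theorem edgeClass_surjective : Function.Surjective L.edgeClass := Quot.exists_rep

theorem IsFundamentalGroupoid.exists_triangle [KanComplex L] {S : CatStr L.EdgeClass (L _⦋0⦌)}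
    (hS : L.IsFundamentalGroupoid S) {f g : L.EdgeClass} (h : S.s f = S.t g) :
    ∃ γ : L _⦋2⦌, L.edgeClass (L.δ 2 γ) = f ∧ L.edgeClass (L.δ 0 γ) = g := by
  obtain ⟨x, rfl⟩ := edgeClass_surjective f
  obtain ⟨y, rfl⟩ := edgeClass_surjective g
  rw [hS.s_mk, hS.t_mk] at h
  obtain ⟨γ, h₀, h₂⟩ := KanComplex.exists_filler₂₁ y x h
  exact ⟨γ, by rw [h₂], by rw [h₀]⟩

theorem IsFundamentalGroupoid.comp_mk {S : CatStr L.EdgeClass (L _⦋0⦌)}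
    (hS : L.IsFundamentalGroupoid S) (γ : L _⦋2⦌) (h) :
    S.comp (L.edgeClass (L.δ 2 γ)) (L.edgeClass (L.δ 0 γ)) h = L.edgeClass (L.δ 1 γ) :=
  hS.comp_eq _ _ h γ rfl rfl

theorem IsFundamentalGroupoid.unique [KanComplex L] {S S' : CatStr L.EdgeClass (L _⦋0⦌)}
    (hS : L.IsFundamentalGroupoid S) (hS' : L.IsFundamentalGroupoid S') : S = S' := by
  refine CatStr.ext_of_comp (funext fun f => ?_) (funext fun f => ?_) (funext fun a => ?_) ?_
  · obtain ⟨x, rfl⟩ := edgeClass_surjective f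
    rw [hS.s_mk, hS'.s_mk]
  · obtain ⟨x, rfl⟩ := edgeClass_surjective f
    rw [hS.t_mk, hS'.t_mk]
  · rw [hS.I_eq, hS'.I_eq]
  · intro f g h h'
    obtain ⟨γ, rfl, rfl⟩ := hS.exists_triangle h
    rw [hS.comp_mk, hS'.comp_mk]

theorem exists_associative_composites [KanComplex L] {x y z : L _⦋1⦌} (hxy : L.δ 0 x = L.δ 1 y)
    (hyz : L.δ 0 y = L.δ 1 z) : ∃ p q r, L.IsComposite x y p ∧ L.IsComposite y z q ∧
      L.IsComposite p z r ∧ L.IsComposite x q r := by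
  obtain ⟨p, hp⟩ := exists_isComposite hxy
  obtain ⟨q, hq⟩ := exists_isComposite hyz
  obtain ⟨r, hr⟩ := exists_isComposite (hp.boundary.2.1.trans hyz)
  exact ⟨p, q, r, hp, hq, hr, hp.assoc' hq hr⟩

theorem exists_isFundamentalGroupoid (L : SSet.{u}) [KanComplex L] :
    ∃ S : CatStr L.EdgeClass (L _⦋0⦌), L.IsFundamentalGroupoid S ∧ S.IsGroupoid := by
  obtain ⟨S, hs, ht, hI, hc, hS⟩ := CatStr.exists_of_relation (M := L.EdgeClass) (O := L _⦋0⦌)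
    (Quot.lift (fun x => L.δ 0 x) fun _ _ h => h.1 0)
    (Quot.lift (fun x => L.δ 1 x) fun _ _ h => h.1 1) (fun a => L.edgeClass (L.σ 0 a))
    (fun f g k => ∃ x y z, L.IsComposite x y z ∧ L.edgeClass x = f ∧ L.edgeClass y = g ∧
      L.edgeClass z = k)
    (fun a => δ₁0σ a) (fun a => δ₁1σ a)
    (by
      rintro _ _ _ ⟨x, y, z, h, rfl, rfl, rfl⟩
      exact h.boundary)
    (by
      intro f g h
      obtain ⟨x, rfl⟩ := edgeClass_surjective f
      obtain ⟨y, rfl⟩ := edgeClass_surjective g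
      obtain ⟨z, hz⟩ := exists_isComposite (x := x) (y := y) h
      exact ⟨_, x, y, z, hz, rfl, rfl, rfl⟩)
    (by
      rintro _ _ _ _ ⟨x, y, z, h, rfl, rfl, rfl⟩ ⟨x', y', z', h', hx, hy, rfl⟩
      exact edgeClass_eq_iff.2 (h.homotopic h' (edgeClass_eq_iff.1 hx).symm
        (edgeClass_eq_iff.1 hy).symm))
    (by
      intro f
      obtain ⟨x, rfl⟩ := edgeClass_surjective f
      exact ⟨_, _, _, isComposite_id x, rfl, rfl, rfl⟩)
    (by
      intro f
      obtain ⟨x, rfl⟩ := edgeClass_surjective f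
      exact ⟨_, _, _, id_isComposite x, rfl, rfl, rfl⟩)
    (by
      intro f g k h₁ h₂
      obtain ⟨x, rfl⟩ := edgeClass_surjective f
      obtain ⟨y, rfl⟩ := edgeClass_surjective g
      obtain ⟨z, rfl⟩ := edgeClass_surjective k
      obtain ⟨p, q, r, hp, hq, hr, hr'⟩ :=
        exists_associative_composites (x := x) (y := y) (z := z) h₁ h₂
      exact ⟨_, _, _, ⟨_, _, _, hp, rfl, rfl, rfl⟩, ⟨_, _, _, hq, rfl, rfl, rfl⟩,
        ⟨_, _, _, hr, rfl, rfl, rfl⟩, ⟨_, _, _, hr', rfl, rfl, rfl⟩⟩)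
    (by
      intro f
      obtain ⟨x, rfl⟩ := edgeClass_surjective f
      obtain ⟨y, hy⟩ := exists_isComposite_id x
      exact ⟨_, _, _, _, hy, rfl, rfl, rfl⟩)
    (by
      intro f
      obtain ⟨x, rfl⟩ := edgeClass_surjective f
      obtain ⟨y, hy⟩ := exists_isComposite_id' x
      exact ⟨_, _, _, _, hy, rfl, rfl, rfl⟩)
  refine ⟨S, ⟨fun x => by rw [hs]; rfl, fun x => by rw [ht]; rfl, fun a => by rw [hI], ?_⟩, hS⟩
  rintro _ _ h γ rfl rfl
  exact hc _ _ _ h ⟨_, _, _, ⟨γ, rfl, rfl, rfl⟩, rfl, rfl, rfl⟩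

end SSet

/-! ### The groupoid of squares in one direction -/

namespace BiSSet

variable {K : BiSSet.{u}}

theorem ExtensionCondition.clsV_eq_iff (hK : K.ExtensionCondition) {u v : K.cell 0 1} :
    K.clsV u = K.clsV v ↔ K.HomotopicV u v :=
  have := hK.vert_kan 0
  SSet.edgeClass_eq_iff

theorem ExtensionCondition.clsH_eq_iff (hK : K.ExtensionCondition) {f g : K.cell 1 0} :
    K.clsH f = K.clsH g ↔ K.HomotopicH f g :=
  have := hK.horiz_kan 0
  SSet.edgeClass_eq_iff

theorem ExtensionCondition.cls_eq_iff (hK : K.ExtensionCondition) {x y : K.cell 1 1} :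
    K.cls x = K.cls y ↔ K.Bihomotopic x y :=
  ⟨fun h => hK.bihomotopic_equivalence.eqvGen_iff.1 (Quot.eqvGen_exact h), fun h => Quot.sound h⟩

theorem ExtensionCondition.clsV_dh_eq (hK : K.ExtensionCondition) {x y : K.cell 1 1}
    (h : K.Bihomotopic x y) (i : Fin 2) : K.clsV (K.dh i x) = K.clsV (K.dh i y) := by
  obtain ⟨z, h, h'⟩ := h
  rw [h.dh_eq i]
  exact hK.clsV_eq_iff.2 (h'.dh i)

/-- Only `x` has to be moved, and only vertically, which is why the composition rule varies the
first factor alone. -/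
theorem ExtensionCondition.exists_composite_of_classes (hK : K.ExtensionCondition)
    {x y : K.cell 1 1} (h : K.HomotopicV (K.dh 0 x) (K.dh 1 y)) :
    ∃ γ : K.cell 2 1, K.HomotopicV x (K.dh 2 γ) ∧ K.dh 0 γ = y := by
  obtain ⟨x', hx, hx'⟩ := hK.exists_homotopicV_dh_eq h
  have := hK.horiz_kan 1
  obtain ⟨γ, h₀, h₂⟩ := SSet.KanComplex.exists_filler₂₁ (L := K.horiz 1) y x' hx'
  exact ⟨γ, by rwa [show K.dh 2 γ = x' from h₂], h₀⟩

/-- The squares are any quotient map `c` whose fibres are the bihomotopy classes. Flipping `K`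
reverses the order of the two homotopies in the definition of bihomotopy, so this generality puts
both category structures on the same set. -/
theorem ExtensionCondition.exists_catStr (hK : K.ExtensionCondition)
    (hπ : ∀ a : K.cell 0 0, Subsingleton ((K.vert 0).PiSucc 1 a)) {C : Type u}
    (c : K.cell 1 1 → C) (hc : Function.Surjective c)
    (hcc : ∀ {x y}, c x = c y ↔ K.Bihomotopic x y) :
    ∃ S : CatStr C K.VMor, (∀ x, S.s (c x) = K.clsV (K.dh 0 x)) ∧
      (∀ x, S.t (c x) = K.clsV (K.dh 1 x)) ∧ (∀ u, S.I (K.clsV u) = c (K.sh 0 u)) ∧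
      (∀ (γ : K.cell 2 1) h, S.comp (c (K.dh 2 γ)) (c (K.dh 0 γ)) h = c (K.dh 1 γ)) ∧
      (∀ f g, S.s f = S.t g → ∃ γ : K.cell 2 1, c (K.dh 2 γ) = f ∧ c (K.dh 0 γ) = g) ∧
      S.IsGroupoid := by
  have := hK.horiz_kan 1
  have hd : ∀ i : Fin 2, ∃ s : C → K.VMor, ∀ x, s (c x) = K.clsV (K.dh i x) := fun i =>
    ⟨fun f => K.clsV (K.dh i (hc f).choose), fun x =>
      hK.clsV_dh_eq (hcc.1 (hc (c x)).choose_spec) i⟩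
  obtain ⟨s, hs⟩ := hd 0
  obtain ⟨t, ht⟩ := hd 1
  obtain ⟨I, hI⟩ : ∃ I : K.VMor → C, ∀ u, I (K.clsV u) = c (K.sh 0 u) :=
    ⟨Quot.lift (fun u => c (K.sh 0 u)) fun u v h =>
      hcc.2 (HomotopicV.bihomotopic hK (HomotopicV.sh h 0)), fun u => rfl⟩
  have hv : Function.Surjective K.clsV := SSet.edgeClass_surjective
  have ex : ∀ {f g}, s f = t g → ∃ γ : K.cell 2 1, c (K.dh 2 γ) = f ∧ c (K.dh 0 γ) = g := by
    intro f g h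
    obtain ⟨x, rfl⟩ := hc f
    obtain ⟨y, rfl⟩ := hc g
    rw [hs, ht, hK.clsV_eq_iff] at h
    obtain ⟨γ, h₂, rfl⟩ := hK.exists_composite_of_classes h
    exact ⟨γ, (hcc.2 (h₂.bihomotopic hK)).symm, rfl⟩
  obtain ⟨S, rfl, rfl, rfl, hcomp, hS⟩ := CatStr.exists_of_relation s t I
    (fun f g k => ∃ γ : K.cell 2 1, c (K.dh 2 γ) = f ∧ c (K.dh 0 γ) = g ∧ c (K.dh 1 γ) = k)
    (fun a => by obtain ⟨u, rfl⟩ := hv a; rw [hI, hs, dh0_sh])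
    (fun a => by obtain ⟨u, rfl⟩ := hv a; rw [hI, ht, dh1_sh])
    (by rintro _ _ _ ⟨γ, rfl, rfl, rfl⟩; simp [hs, ht])
    (fun h => by
      obtain ⟨γ, h₂, h₀⟩ := ex h
      exact ⟨_, γ, h₂, h₀, rfl⟩)
    (by
      rintro _ _ _ _ ⟨γ, rfl, rfl, rfl⟩ ⟨γ', h₂, h₀, rfl⟩
      exact hcc.2 (hK.bihomotopic_composite hπ (hcc.1 h₂.symm) (hcc.1 h₀.symm)))
    (fun f => by
      obtain ⟨x, rfl⟩ := hc f
      exact ⟨K.sh 1 x, by simp, by simp [hs, hI], by simp⟩)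
    (fun f => by
      obtain ⟨x, rfl⟩ := hc f
      exact ⟨K.sh 0 x, by simp [ht, hI], by simp, by simp⟩)
    (by
      intro f g k h₁ h₂
      obtain ⟨z, rfl⟩ := hc k
      obtain ⟨y, rfl⟩ := hc g
      obtain ⟨x, rfl⟩ := hc f
      rw [hs, ht, hK.clsV_eq_iff] at h₁ h₂
      -- The triple is rigidified from the right: `y` is moved to meet `z`, then `x` to meet the
      -- moved `y'`. Associativity then takes place in `K_{*,1}`.
      obtain ⟨y', hy, hy'⟩ := hK.exists_homotopicV_dh_eq h₂
      obtain ⟨x', hx, hx'⟩ := hK.exists_homotopicV_dh_eq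
        ((hK.homotopicV_equivalence 0).trans h₁ (hy.dh 1))
      rw [hcc.2 (hx.bihomotopic hK), hcc.2 (hy.bihomotopic hK)]
      obtain ⟨p, q, r, ⟨γ₃, rfl, rfl, rfl⟩, ⟨γ₀, e, rfl, rfl⟩, ⟨γ₁, e₁, e₂, rfl⟩,
        ⟨γ₂, e₃, e₄, e₅⟩⟩ := SSet.exists_associative_composites (L := K.horiz 1) hx' hy'
      exact ⟨_, _, _, ⟨γ₃, rfl, rfl, rfl⟩, ⟨γ₀, congrArg c e, rfl, rfl⟩,
        ⟨γ₁, congrArg c e₁, congrArg c e₂, rfl⟩, ⟨γ₂, congrArg c e₃, congrArg c e₄, congrArg c e₅⟩⟩)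
    (fun f => by
      obtain ⟨x, rfl⟩ := hc f
      obtain ⟨y, γ, h₂, h₀, h₁⟩ := SSet.exists_isComposite_id (L := K.horiz 1) x
      exact ⟨c y, γ, congrArg c h₂, congrArg c h₀, by rw [ht, hI]; exact congrArg c h₁⟩)
    (fun f => by
      obtain ⟨x, rfl⟩ := hc f
      obtain ⟨y, γ, h₂, h₀, h₁⟩ := SSet.exists_isComposite_id' (L := K.horiz 1) x
      exact ⟨c y, γ, congrArg c h₂, congrArg c h₀, by rw [hs, hI]; exact congrArg c h₁⟩)
  exact ⟨S, hs, ht, hI, fun γ h => hcomp _ _ _ h ⟨γ, rfl, rfl, rfl⟩,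
    fun _ _ h => ex h, hS⟩

end BiSSet

/-! ### The homotopy double groupoid: existence, uniqueness, filling -/

namespace BiSSet

variable {K : BiSSet.{u}}

theorem cls_surjective : Function.Surjective K.cls := Quot.exists_rep

theorem clsH_surjective : Function.Surjective K.clsH := Quot.exists_rep

theorem clsV_surjective : Function.Surjective K.clsV := Quot.exists_rep

namespace ExtensionCondition

variable (hK : K.ExtensionCondition)

include hK

theorem exists_isHomotopyDoubleGroupoid
    (hπh : ∀ a : K.cell 0 0, Subsingleton ((K.horiz 0).PiSucc 1 a))
    (hπv : ∀ a : K.cell 0 0, Subsingleton ((K.vert 0).PiSucc 1 a)) :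
    ∃ G : DoubleCategory (K.cell 0 0) K.HMor K.VMor K.Square,
      K.IsHomotopyDoubleGroupoid G ∧ G.IsDoubleGroupoid := by
  have := hK.horiz_kan 0
  have := hK.vert_kan 0
  obtain ⟨hor, hh, gh⟩ := SSet.exists_isFundamentalGroupoid (K.horiz 0)
  obtain ⟨ver, hv, gv⟩ := SSet.exists_isFundamentalGroupoid (K.vert 0)
  obtain ⟨sqH, sH, tH, IH, cH, exH, gH⟩ := hK.exists_catStr hπv K.cls cls_surjective hK.cls_eq_iff
  obtain ⟨sqV, sV, tV, IV, cV, exV, gV⟩ : ∃ S : CatStr K.Square K.HMor,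
      (∀ x, S.s (K.cls x) = K.clsH (K.dv 0 x)) ∧
      (∀ x, S.t (K.cls x) = K.clsH (K.dv 1 x)) ∧ (∀ u, S.I (K.clsH u) = K.cls (K.sv 0 u)) ∧
      (∀ (γ : K.cell 1 2) h,
        S.comp (K.cls (K.dv 2 γ)) (K.cls (K.dv 0 γ)) h = K.cls (K.dv 1 γ)) ∧
      (∀ f g, S.s f = S.t g → ∃ γ : K.cell 1 2, K.cls (K.dv 2 γ) = f ∧ K.cls (K.dv 0 γ) = g) ∧
      S.IsGroupoid :=
    hK.flip.exists_catStr hπh K.cls cls_surjective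
      (hK.cls_eq_iff.trans hK.bihomotopic_flip_iff.symm)
  have sh : ∀ f, hor.s (K.clsH f) = K.dh 0 f := hh.s_mk
  have th : ∀ f, hor.t (K.clsH f) = K.dh 1 f := hh.t_mk
  have Ih : ∀ a, hor.I a = K.clsH (K.sh 0 a) := hh.I_eq
  have ch : ∀ (γ : K.cell 2 0) h,
      hor.comp (K.clsH (K.dh 2 γ)) (K.clsH (K.dh 0 γ)) h = K.clsH (K.dh 1 γ) := hh.comp_mk
  have sv : ∀ u, ver.s (K.clsV u) = K.dv 0 u := hv.s_mk
  have tv : ∀ u, ver.t (K.clsV u) = K.dv 1 u := hv.t_mk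
  have Iv : ∀ a, ver.I a = K.clsV (K.sv 0 a) := hv.I_eq
  have cv : ∀ (γ : K.cell 0 2) h,
      ver.comp (K.clsV (K.dv 2 γ)) (K.clsV (K.dv 0 γ)) h = K.clsV (K.dv 1 γ) := hv.comp_mk
  -- Passing the faces through equations lets a witness such as `K.dv 0 γ` be used with its faces in
  -- the form `dv 0 (dh i γ)`.
  have ch' : ∀ (γ : K.cell 2 0) {x y z}, K.dh 2 γ = x → K.dh 0 γ = y → K.dh 1 γ = z → ∀ h,
      hor.comp (K.clsH x) (K.clsH y) h = K.clsH z := by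
    rintro γ _ _ _ rfl rfl rfl h
    exact ch γ h
  have cH' : ∀ (γ : K.cell 2 1) {x y z}, K.dh 2 γ = x → K.dh 0 γ = y → K.dh 1 γ = z → ∀ h,
      sqH.comp (K.cls x) (K.cls y) h = K.cls z := by
    rintro γ _ _ _ rfl rfl rfl h
    exact cH γ h
  have cV' : ∀ (γ : K.cell 1 2) {x y z}, K.dv 2 γ = x → K.dv 0 γ = y → K.dv 1 γ = z → ∀ h,
      sqV.comp (K.cls x) (K.cls y) h = K.cls z := by
    rintro γ _ _ _ rfl rfl rfl h
    exact cV γ h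
  let G : DoubleCategory (K.cell 0 0) K.HMor K.VMor K.Square :=
    { hor := hor
      ver := ver
      sqH := sqH
      sqV := sqV
      s_s := fun α => by
        obtain ⟨x, rfl⟩ := cls_surjective α
        rw [sV, sH, sh, sv, dh_dv]
      t_t := fun α => by
        obtain ⟨x, rfl⟩ := cls_surjective α
        rw [tV, tH, th, tv, dh_dv]
      s_t := fun α => by
        obtain ⟨x, rfl⟩ := cls_surjective α
        rw [tV, sH, sh, tv, dh_dv]
      t_s := fun α => by
        obtain ⟨x, rfl⟩ := cls_surjective α
        rw [sV, tH, th, sv, dh_dv]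
      sH_IV := fun f => by
        obtain ⟨x, rfl⟩ := clsH_surjective f
        rw [IV, sH, sh, Iv, dh_sv]
      tH_IV := fun f => by
        obtain ⟨x, rfl⟩ := clsH_surjective f
        rw [IV, tH, th, Iv, dh_sv]
      sV_IH := fun u => by
        obtain ⟨x, rfl⟩ := clsV_surjective u
        rw [IH, sV, sv, Ih, dv_sh]
      tV_IH := fun u => by
        obtain ⟨x, rfl⟩ := clsV_surjective u
        rw [IH, tV, tv, Ih, dv_sh]
      I_I := fun a => by rw [Iv, Ih, IH, IV, sh_sv]
      sV_comp := fun α β h => by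
        obtain ⟨γ, rfl, rfl⟩ := exH α β h
        simp only [cH, sV, ch' (K.dv 0 γ) (dh_dv ..) (dh_dv ..) (dh_dv ..)]
      tV_comp := fun α β h => by
        obtain ⟨γ, rfl, rfl⟩ := exH α β h
        simp only [cH, tV, ch' (K.dv 1 γ) (dh_dv ..) (dh_dv ..) (dh_dv ..)]
      sH_comp := fun α β h => by
        obtain ⟨γ, rfl, rfl⟩ := exV α β h
        simp only [cV, sH, dh_dv, cv]
      tH_comp := fun α β h => by
        obtain ⟨γ, rfl, rfl⟩ := exV α β h
        simp only [cV, tH, dh_dv, cv]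
      IV_comp := fun f g h => by
        obtain ⟨γ, rfl, rfl⟩ : ∃ γ : K.cell 2 0, K.clsH (K.dh 2 γ) = f ∧ K.clsH (K.dh 0 γ) = g :=
          hh.exists_triangle h
        simp only [ch, IV, cH' (K.sv 0 γ) (dh_sv ..) (dh_sv ..) (dh_sv ..)]
      IH_comp := fun u v h => by
        obtain ⟨γ, rfl, rfl⟩ : ∃ γ : K.cell 0 2, K.clsV (K.dv 2 γ) = u ∧ K.clsV (K.dv 0 γ) = v :=
          hv.exists_triangle h
        simp only [cv, IH, cV' (K.sh 0 γ) (dv_sh ..) (dv_sh ..) (dv_sh ..)]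
      interchange := fun α β γ δ h₁ h₂ h₃ h₄ => by
        obtain ⟨a, rfl⟩ := cls_surjective α
        obtain ⟨b, rfl⟩ := cls_surjective β
        obtain ⟨c, rfl⟩ := cls_surjective γ
        obtain ⟨d, rfl⟩ := cls_surjective δ
        obtain ⟨z, ha, hb, hc, hd⟩ := hK.exists_grid (a := a) (b := b) (c := c) (d := d)
          (hK.clsV_eq_iff.1 (by rw [← sH, h₁, tH])) (hK.clsV_eq_iff.1 (by rw [← sH, h₂, tH]))
          (hK.clsH_eq_iff.1 (by rw [← sV, h₃, tV])) (hK.clsH_eq_iff.1 (by rw [← sV, h₄, tV]))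
        -- The rows 0 and 2 of `z` compose the given squares horizontally, and row 1 composes the
        -- two vertical composites; the vertical steps are `cV` on the faces `dh i z`.
        have cz := fun j : Fin 3 => cH' (K.dv j z) (dh_dv ..) (dh_dv ..) (dh_dv ..)
        simp only [hK.cls_eq_iff.2 ha, hK.cls_eq_iff.2 hb, hK.cls_eq_iff.2 hc,
          hK.cls_eq_iff.2 hd, dh_dv, cz, cV] }
  refine ⟨G, ⟨hh, hv, sH, tH, sV, tV, IH, IV, ?_, ?_⟩, gh, gv, gH, gV⟩
  · rintro x _ h _ γ hx rfl rfl
    simp only [hK.cls_eq_iff.2 (hx.bihomotopic hK)]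
    exact cH γ _
  · rintro x _ h _ γ hx rfl rfl
    simp only [hK.cls_eq_iff.2 (hx.bihomotopic hK)]
    exact cV γ _

theorem isHomotopyDoubleGroupoid_unique
    {G G' : DoubleCategory (K.cell 0 0) K.HMor K.VMor K.Square}
    (h : K.IsHomotopyDoubleGroupoid G) (h' : K.IsHomotopyDoubleGroupoid G') : G = G' := by
  have := hK.horiz_kan 0
  have := hK.vert_kan 0
  refine DoubleCategory.ext (h.hor.unique h'.hor) (h.ver.unique h'.ver)
    (CatStr.ext_of_comp (funext fun α => ?_) (funext fun α => ?_) (funext fun u => ?_) ?_)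
    (CatStr.ext_of_comp (funext fun α => ?_) (funext fun α => ?_) (funext fun f => ?_) ?_)
  · obtain ⟨x, rfl⟩ := cls_surjective α
    rw [h.sH, h'.sH]
  · obtain ⟨x, rfl⟩ := cls_surjective α
    rw [h.tH, h'.tH]
  · obtain ⟨x, rfl⟩ := clsV_surjective u
    rw [h.IH, h'.IH]
  · intro α β e e'
    obtain ⟨x, rfl⟩ := cls_surjective α
    obtain ⟨y, rfl⟩ := cls_surjective β
    -- Every composable pair of classes has a witness of the prescribed form, so the rule for
    -- `compH` determines the composition.
    obtain ⟨γ, h₂, h₀⟩ := hK.exists_composite_of_classes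
      (hK.clsV_eq_iff.1 (by rw [← h.sH, e, h.tH]))
    rw [h.compH x y e _ γ h₂ rfl h₀, h'.compH x y e' _ γ h₂ rfl h₀]
  · obtain ⟨x, rfl⟩ := cls_surjective α
    rw [h.sV, h'.sV]
  · obtain ⟨x, rfl⟩ := cls_surjective α
    rw [h.tV, h'.tV]
  · obtain ⟨x, rfl⟩ := clsH_surjective f
    rw [h.IV, h'.IV]
  · intro α β e e'
    obtain ⟨x, rfl⟩ := cls_surjective α
    obtain ⟨y, rfl⟩ := cls_surjective β
    obtain ⟨γ, h₂, h₀⟩ : ∃ γ : K.cell 1 2, K.HomotopicH x (K.dv 2 γ) ∧ K.dv 0 γ = y :=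
      hK.flip.exists_composite_of_classes
        (hK.clsH_eq_iff.1 ((h.sV x).symm.trans (e.trans (h.tV y))))
    rw [h.compV x y e _ γ h₂ rfl h₀, h'.compV x y e' _ γ h₂ rfl h₀]

theorem fillingCondition {G : DoubleCategory (K.cell 0 0) K.HMor K.VMor K.Square}
    (h : K.IsHomotopyDoubleGroupoid G) : G.FillingCondition := by
  intro g u e
  obtain ⟨f, rfl⟩ := clsH_surjective g
  obtain ⟨w, rfl⟩ := clsV_surjective u
  -- Sources and targets of edge classes are actual vertices, so any representatives of the corner
  -- form a (1,1)-bihorn.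
  obtain ⟨z, rfl, rfl⟩ := hK.exists_filler₁₁ w f
    ((h.hor.s_mk f).symm.trans (e.trans (h.ver.t_mk w)))
  exact ⟨K.cls z, h.sH z, h.tV z⟩

end ExtensionCondition

end BiSSet

theorem theorem6p2 (K : BiSSet.{u}) (hK : K.ExtensionCondition)
    (hπh : ∀ a : K.cell 0 0, Subsingleton ((K.horiz 0).PiSucc 1 a))
    (hπv : ∀ a : K.cell 0 0, Subsingleton ((K.vert 0).PiSucc 1 a)) :
    -- homotopy of edges and bihomotopy of bisimplices are equivalence relations
    _root_.Equivalence (fun f f' : K.cell 1 0 => K.HomotopicH f f') ∧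
    _root_.Equivalence (fun u u' : K.cell 0 1 => K.HomotopicV u u') ∧
    _root_.Equivalence (fun x x' : K.cell 1 1 => K.Bihomotopic x x') ∧
    -- the homotopy double groupoid exists, is unique, and has the filling condition
    ∃ G : DoubleCategory (K.cell 0 0) K.HMor K.VMor K.Square,
      K.IsHomotopyDoubleGroupoid G ∧ G.IsDoubleGroupoid ∧ G.FillingCondition ∧
      ∀ G' : DoubleCategory (K.cell 0 0) K.HMor K.VMor K.Square,
        K.IsHomotopyDoubleGroupoid G' → G' = G := by
  obtain ⟨G, hG, hG'⟩ := hK.exists_isHomotopyDoubleGroupoid hπh hπv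
  exact ⟨hK.homotopicH_equivalence 0, hK.homotopicV_equivalence 0, hK.bihomotopic_equivalence, G,
    hG, hG', hK.fillingCondition hG, fun _ h => hK.isHomotopyDoubleGroupoid_unique h hG⟩
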